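/- Corollary 7. Let $F$ be a probability distribution on $(0,\infty)$ that has a continuous and strictly positive density on $(0,\infty)$. Let $n\ge 3$, let $X_1,\dots,X_n$ be independent random variables with common distribution $F$, let $X_{(1)}\le X_{(2)}\le\cdots\le X_{(n)}$ be their order statistics, and let $\overline{X}_n=\frac1n\sum_{i=1}^n X_i$ be the sample mean. Let $p>0$, $q>0$ and $a_{ij}\ge 0$ ($1\le i,j\le n$) be arbitrary real numbers with $a_{11}>0$ and $a_{nn}>0$, and set $$Z_n=\sum_{i=1}^n\sum_{j=1}^n a_{ij}\,|X_{(i)}-\overline{X}_n|^p\,|X_{(j)}-\overline{X}_n|^q .$$ Then $\overline{X}_n$ and $Z_n^{1/(p+q)}/\overline{X}_n$ are independent if and only if $F$ is a gamma distribution, i.e. there are $a>0$ and $b>0$ such that $F$ has the density $\frac{1}{\Gamma(a)\,b^a}\,x^{a-1}e^{-x/b}$ for $x>0$ (and $0$ for $x\le 0$). -/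

import Mathlib

open MeasureTheory ProbabilityTheory

namespace GammaCharacterization

/-- The probability law `μ` is carried by `(0, ∞)` and has there a density with respect to
Lebesgue measure that is continuous and strictly positive at every point of `(0, ∞)`. -/
def HasPositiveContinuousDensity (μ : Measure ℝ) : Prop :=
  ∃ f : ℝ → ℝ, ContinuousOn f (Set.Ioi 0) ∧ (∀ x, 0 < x → 0 < f x) ∧
    μ = (volume.restrict (Set.Ioi (0 : ℝ))).withDensity (fun x => ENNReal.ofReal (f x))

/-- `μ` is a gamma distribution, with some shape `a > 0` and some scale `b > 0`.
(The second argument of `gammaMeasure` is the rate, the reciprocal of the scale.) -/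
def IsGammaDistribution (μ : Measure ℝ) : Prop :=
  ∃ a b : ℝ, 0 < a ∧ 0 < b ∧ μ = gammaMeasure a (1 / b)

/-- The mean `(x₁ + ⋯ + xₙ) / n` of a finite sequence. -/
noncomputable def mean {n : ℕ} (x : Fin n → ℝ) : ℝ :=
  (∑ i, x i) / (n : ℝ)

/-- The order statistics `x₍₁₎ ≤ ⋯ ≤ x₍ₙ₎` of a finite sequence: its values in nondecreasing
order, with multiplicity (`Tuple.sort x` is a permutation that sorts `x`). -/
noncomputable def orderStatistic {n : ℕ} (x : Fin n → ℝ) (i : Fin n) : ℝ :=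
  x (Tuple.sort x i)

/-- The quantity `∑ᵢ ∑ⱼ aᵢⱼ |x₍ᵢ₎ - x̄|ᵖ |x₍ⱼ₎ - x̄|^q`. -/
noncomputable def zStatistic {n : ℕ} (p q : ℝ) (a : Fin n → Fin n → ℝ) (x : Fin n → ℝ) : ℝ :=
  ∑ i, ∑ j, a i j * |orderStatistic x i - mean x| ^ p * |orderStatistic x j - mean x| ^ q

end GammaCharacterization

/-! Only three properties of `τ = Z ^ (1/(p+q))` matter: it is continuous, `τ(t + c x) = c τ(x)` for
`c > 0`, and it dominates every deviation from the mean. Write `n = k + 1` and `x i = m (1 + w i)`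
with `m` the mean and `∑ w i = 0`. Then `τ(x)/m = τ(w)`, and the joint density in `(m, w)` is a
constant times `m^k ∏ f(m (1 + w i))`. For a gamma density this product splits into a function of
`m` times a function of `w`, which gives independence.

Conversely, let `W(ε, m)` be the integral of `∏ f(m (1 + w i))` over `τ(w) ≤ ε`. Independence makes
`W(ε, m)/W(ε', m)` free of `m` for small `ε, ε'`. Letting `ε' → 0` shows that `W(ε, m)/f(m)^n` is
free of `m` (`eventually_localWeight_mul_pow_eq`).

No derivative of `f` is available, so second-order information comes from touching parabolas. If
`log f + λ log` is not convex, some strictly concave parabola touches it from above at a point `m`.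
Since `∑ w i = 0`, linear terms cancel, and `W(ε, m)/f(m)^n < V(ε) + (λ/2) Q(ε)` for small `ε`,
where `V` is the volume of the region and `Q` the integral of `∑ w i ^ 2`. If it is not concave, the
reverse inequality holds at another point. The two are incompatible, so for every `λ` the function
is convex or concave (`convexOn_or_concaveOn_log_add`). By connectedness of the line some `λ` gives
both (`exists_eq_log_add_affine`); then `log f` is affine plus a multiple of `log`, and
integrability leaves only gamma densities. -/

namespace GammaCharacterization

open scoped ENNReal Topology

/-- A continuous, translation invariant statistic, homogeneous of degree one, that dominates the
deviations from the mean. -/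
structure IsDispersion {n : ℕ} (τ : (Fin n → ℝ) → ℝ) : Prop where
  continuous : Continuous τ
  affine : ∀ (x : Fin n → ℝ) (c t : ℝ), 0 < c → τ (fun i => t + c * x i) = c * τ x
  bound : ∃ M : ℝ, 0 < M ∧ ∀ x : Fin n → ℝ, ∀ i, |x i - mean x| ≤ M * τ x

/-! ### Order statistics, and the root of `zStatistic` as a dispersion. -/

section OrderStatistics

variable {n : ℕ}

theorem orderStatistic_eq_of_monotone {x : Fin n → ℝ} {σ : Equiv.Perm (Fin n)}
    (h : Monotone (x ∘ σ)) (i : Fin n) : orderStatistic x i = x (σ i) :=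
  (congrFun (Tuple.comp_sort_eq_comp_iff_monotone.mpr h) i).symm

theorem orderStatistic_mono (x : Fin n → ℝ) : Monotone (orderStatistic x) :=
  Tuple.monotone_sort x

/-- Finitely many closed chambers, one for each sorting permutation, cover the space; on each of
them the order statistic is a coordinate. -/
theorem continuous_orderStatistic (i : Fin n) :
    Continuous fun x : Fin n → ℝ => orderStatistic x i := by
  refine LocallyFinite.continuous (f := fun σ : Equiv.Perm (Fin n) =>
    {x : Fin n → ℝ | Monotone (x ∘ σ)}) (locallyFinite_of_finite _) ?_ ?_ ?_
  · exact Set.eq_univ_of_forall fun x => Set.mem_iUnion.mpr ⟨Tuple.sort x, Tuple.monotone_sort x⟩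
  · intro σ
    have : {x : Fin n → ℝ | Monotone (x ∘ σ)} =
        ⋂ (a : Fin n) (b : Fin n) (_ : a ≤ b), {x | x (σ a) ≤ x (σ b)} := by
      ext x; simp [Monotone]
    rw [this]
    exact isClosed_iInter fun a => isClosed_iInter fun b => isClosed_iInter fun _ =>
      isClosed_le (continuous_apply _) (continuous_apply _)
  · intro σ
    exact (continuous_apply (σ i)).continuousOn.congr fun x hx => orderStatistic_eq_of_monotone hx i

theorem orderStatistic_affine (x : Fin n → ℝ) (c t : ℝ) (hc : 0 < c) (i : Fin n) :
    orderStatistic (fun j => t + c * x j) i = t + c * orderStatistic x i := by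
  refine orderStatistic_eq_of_monotone (σ := Tuple.sort x) (fun a b hab => ?_) i
  have := Tuple.monotone_sort x hab
  simp only [Function.comp_apply] at this ⊢
  gcongr

theorem continuous_mean : Continuous (mean : (Fin n → ℝ) → ℝ) := by
  unfold mean; fun_prop

theorem mean_affine (hn : n ≠ 0) (x : Fin n → ℝ) (c t : ℝ) :
    mean (fun j => t + c * x j) = t + c * mean x := by
  have : (n : ℝ) ≠ 0 := by exact_mod_cast hn
  simp only [mean, Finset.sum_add_distrib, ← Finset.mul_sum, Finset.sum_const, Finset.card_univ,
    Fintype.card_fin, nsmul_eq_mul]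
  field_simp

variable {p q : ℝ} {a : Fin n → Fin n → ℝ}

theorem zStatistic_nonneg (ha : ∀ i j, 0 ≤ a i j) (x : Fin n → ℝ) : 0 ≤ zStatistic p q a x :=
  Finset.sum_nonneg fun i _ => Finset.sum_nonneg fun j _ => by
    have := ha i j
    positivity

theorem continuous_zStatistic (hp : 0 < p) (hq : 0 < q) : Continuous (zStatistic p q a) := by
  have h (r : ℝ) (hr : 0 < r) (i : Fin n) :
      Continuous fun x : Fin n → ℝ => |orderStatistic x i - mean x| ^ r :=
    (((continuous_orderStatistic i).sub continuous_mean).abs).rpow_const fun _ => Or.inr hr.le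
  unfold zStatistic
  exact continuous_finsetSum _ fun i _ => continuous_finsetSum _ fun j _ =>
    (continuous_const.mul (h p hp i)).mul (h q hq j)

theorem zStatistic_affine (hn : n ≠ 0) (x : Fin n → ℝ) (c t : ℝ) (hc : 0 < c) :
    zStatistic p q a (fun j => t + c * x j) = c ^ (p + q) * zStatistic p q a x := by
  simp only [zStatistic, orderStatistic_affine x c t hc, mean_affine hn, Finset.mul_sum]
  refine Finset.sum_congr rfl fun i _ => Finset.sum_congr rfl fun j _ => ?_
  have h (y z : ℝ) : |t + c * y - (t + c * z)| = c * |y - z| := by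
    rw [← abs_of_pos hc, ← abs_mul, abs_of_pos hc]; congr 1; ring
  rw [h, h, Real.mul_rpow hc.le (abs_nonneg _), Real.mul_rpow hc.le (abs_nonneg _),
    Real.rpow_add hc]
  ring

theorem mul_abs_rpow_le_zStatistic (hp : 0 < p) (hq : 0 < q) (ha : ∀ i j, 0 ≤ a i j)
    (x : Fin n → ℝ) (i : Fin n) :
    a i i * |orderStatistic x i - mean x| ^ (p + q) ≤ zStatistic p q a x := by
  rw [Real.rpow_add_of_nonneg (abs_nonneg _) hp.le hq.le, ← mul_assoc]
  have h (i j : Fin n) : 0 ≤ a i j * |orderStatistic x i - mean x| ^ p *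
      |orderStatistic x j - mean x| ^ q := by
    have := ha i j
    positivity
  exact (Finset.single_le_sum (f := fun j => a i j * |orderStatistic x i - mean x| ^ p *
      |orderStatistic x j - mean x| ^ q) (fun j _ => h i j) (Finset.mem_univ i)).trans
    (Finset.single_le_sum (f := fun i => ∑ j, a i j * |orderStatistic x i - mean x| ^ p *
      |orderStatistic x j - mean x| ^ q) (fun i _ => Finset.sum_nonneg fun j _ => h i j)
      (Finset.mem_univ i))

theorem abs_orderStatistic_sub_mean_le (hp : 0 < p) (hq : 0 < q) (ha : ∀ i j, 0 ≤ a i j)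
    (x : Fin n → ℝ) {i : Fin n} (hi : 0 < a i i) :
    |orderStatistic x i - mean x| ≤
      (a i i)⁻¹ ^ (1 / (p + q)) * zStatistic p q a x ^ (1 / (p + q)) := by
  have hpq : 0 < p + q := by positivity
  rw [← Real.mul_rpow (by positivity) (zStatistic_nonneg ha x), one_div,
    Real.le_rpow_inv_iff_of_pos (abs_nonneg _)
      (mul_nonneg (by positivity) (zStatistic_nonneg ha x)) hpq]
  rw [inv_mul_eq_div, le_div_iff₀ hi, mul_comm]
  exact mul_abs_rpow_le_zStatistic hp hq ha x i

/-- The two extreme diagonal terms control the smallest and largest order statistics, and every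
coordinate lies between these. -/
theorem isDispersion_zStatistic_rpow (hn : 0 < n) (hp : 0 < p) (hq : 0 < q)
    (ha : ∀ i j, 0 ≤ a i j) (ha_first : 0 < a ⟨0, by omega⟩ ⟨0, by omega⟩)
    (ha_last : 0 < a ⟨n - 1, by omega⟩ ⟨n - 1, by omega⟩) :
    IsDispersion fun x : Fin n → ℝ => zStatistic p q a x ^ (1 / (p + q)) where
  continuous := (continuous_zStatistic hp hq).rpow_const fun _ => Or.inr (by positivity)
  affine x c t hc := by
    have hpq : p + q ≠ 0 := by positivity
    rw [zStatistic_affine hn.ne' x c t hc, Real.mul_rpow (by positivity) (zStatistic_nonneg ha x),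
      ← Real.rpow_mul hc.le, mul_one_div_cancel hpq, Real.rpow_one]
  bound := by
    set c := (a ⟨0, by omega⟩ ⟨0, by omega⟩)⁻¹ ^ (1 / (p + q))
    set d := (a ⟨n - 1, by omega⟩ ⟨n - 1, by omega⟩)⁻¹ ^ (1 / (p + q))
    have hc : 0 < c := by positivity
    have hd : 0 < d := by positivity
    refine ⟨c + d, by positivity, fun x i => ?_⟩
    have h1 := abs_le.mp (abs_orderStatistic_sub_mean_le hp hq ha x ha_first)
    have h2 := abs_le.mp (abs_orderStatistic_sub_mean_le hp hq ha x ha_last)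
    have hz : 0 ≤ zStatistic p q a x ^ (1 / (p + q)) :=
      Real.rpow_nonneg (zStatistic_nonneg ha x) _
    obtain ⟨j, rfl⟩ := (Tuple.sort x).surjective i
    have h3 : orderStatistic x ⟨0, by omega⟩ ≤ orderStatistic x j :=
      orderStatistic_mono x (Fin.mk_le_of_le_val (Nat.zero_le _))
    have h4 : orderStatistic x j ≤ orderStatistic x ⟨n - 1, by omega⟩ :=
      orderStatistic_mono x (Fin.mk_le_mk.mpr (by omega))
    change |orderStatistic x j - mean x| ≤ _
    rw [abs_le]
    constructor <;> nlinarith [h1.1, h2.2, mul_nonneg hc.le hz, mul_nonneg hd.le hz]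

end OrderStatistics

/-! ### Mean and deviation coordinates. -/

section Coordinates

variable {k : ℕ}

/-- The vector with coordinate sum zero whose last coordinates are `u`. -/
def deviation (u : Fin k → ℝ) : Fin (k + 1) → ℝ :=
  Fin.cons (-∑ j, u j) u

@[simp]
theorem sum_deviation (u : Fin k → ℝ) : ∑ i, deviation u i = 0 := by
  simp [deviation, Fin.sum_univ_succ]

theorem deviation_smul (c : ℝ) (u : Fin k → ℝ) (i : Fin (k + 1)) :
    deviation (c • u) i = c * deviation u i := by
  refine Fin.cases ?_ (fun j => ?_) i <;> simp [deviation, Finset.mul_sum]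

@[simp]
theorem deviation_zero : deviation (0 : Fin k → ℝ) = 0 := by
  funext i
  simpa using deviation_smul 0 (0 : Fin k → ℝ) i

theorem deviation_add (u v : Fin k → ℝ) (i : Fin (k + 1)) :
    deviation (u + v) i = deviation u i + deviation v i := by
  refine Fin.cases ?_ (fun j => ?_) i <;> simp [deviation, Finset.sum_add_distrib, add_comm]

@[simp]
theorem deviation_succ (u : Fin k → ℝ) (j : Fin k) : deviation u j.succ = u j := by
  simp [deviation]

theorem continuous_deviation : Continuous (deviation : (Fin k → ℝ) → Fin (k + 1) → ℝ) := by
  refine continuous_pi fun i => ?_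
  refine Fin.cases ?_ (fun j => ?_) i
  · simp only [deviation, Fin.cons_zero]; fun_prop
  · simp only [deviation_succ]; fun_prop

theorem mean_add_deviation (m : ℝ) (u : Fin k → ℝ) : mean (fun i => m + deviation u i) = m := by
  have : (k + 1 : ℝ) ≠ 0 := by positivity
  simp [mean, Finset.sum_add_distrib]
  field_simp

/-- Decomposition of a vector into its mean and its deviations from the mean. -/
noncomputable def meanDeviationEquiv (k : ℕ) : (ℝ × (Fin k → ℝ)) ≃ₗ[ℝ] (Fin (k + 1) → ℝ) where
  toFun y i := y.1 + deviation y.2 i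
  map_add' y z := by funext i; simp [deviation_add]; ring
  map_smul' c y := by funext i; simp [deviation_smul]; ring
  invFun x := (mean x, fun j => x j.succ - mean x)
  left_inv y := by ext <;> simp [mean_add_deviation]
  right_inv x := by
    have hk : (k + 1 : ℝ) ≠ 0 := by positivity
    have h : ∑ i, x i = (k + 1) * mean x := by simp [mean]; field_simp
    funext i
    refine Fin.cases ?_ (fun j => ?_) i
    · rw [Fin.sum_univ_succ] at h
      simp [deviation]; linarith
    · simp

/-- Uniqueness of Haar measure replaces the Jacobian: its value is irrelevant, provided it is
neither `0` nor `⊤`. -/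
theorem exists_lintegral_eq_mul_lintegral_deviation (k : ℕ) :
    ∃ c : ℝ≥0∞, c ≠ 0 ∧ c ≠ ⊤ ∧ ∀ H : (Fin (k + 1) → ℝ) → ℝ≥0∞, Measurable H →
      ∫⁻ x, H x = c * ∫⁻ m : ℝ, ∫⁻ u : Fin k → ℝ, H (fun i => m + deviation u i) := by
  let L := (meanDeviationEquiv k).toContinuousLinearEquiv
  have hvol : (volume : Measure (ℝ × (Fin k → ℝ))).IsAddHaarMeasure :=
    Measure.prod.instIsAddHaarMeasure _ _
  have hL : (Measure.map L volume).IsAddHaarMeasure := L.isAddHaarMeasure_map volume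
  refine ⟨Measure.addHaarScalarFactor volume (Measure.map L volume), ?_,
    ENNReal.coe_ne_top, fun H hH => ?_⟩
  · exact_mod_cast (Measure.addHaarScalarFactor_pos_of_isAddHaarMeasure _ _).ne'
  · have h := Measure.isAddLeftInvariant_eq_smul (volume : Measure (Fin (k + 1) → ℝ))
      (Measure.map L volume)
    have hLm : Measurable L := L.continuous.measurable
    conv_lhs => rw [h]
    rw [lintegral_smul_measure, lintegral_map hH hLm]
    exact congrArg _ (lintegral_prod (μ := (volume : Measure ℝ))
      (ν := (volume : Measure (Fin k → ℝ))) _ (hH.comp hLm).aemeasurable)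

theorem lintegral_eq_pow_mul_lintegral_smul {m : ℝ} (hm : 0 < m) (G : (Fin k → ℝ) → ℝ≥0∞) :
    ∫⁻ u, G u = ENNReal.ofReal (m ^ k) * ∫⁻ w, G (m • w) := by
  have h := Measure.map_addHaar_smul (volume : Measure (Fin k → ℝ)) hm.ne'
  have h2 : ∫⁻ w, G (m • w) = ∫⁻ u, G u ∂(Measure.map (m • ·) volume) :=
    ((measurableEmbedding_const_smul₀ hm.ne').lintegral_map G).symm
  rw [h2, h, lintegral_smul_measure, Module.finrank_fin_fun, smul_eq_mul, ← mul_assoc,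
    ← ENNReal.ofReal_mul (by positivity), abs_of_pos (by positivity),
    mul_inv_cancel₀ (by positivity), ENNReal.ofReal_one, one_mul]

end Coordinates

/-! ### Density of a product measure. -/

section ProductDensity

theorem lintegral_fin_prod {n : ℕ} (g : Fin n → ℝ → ℝ≥0∞) (hg : ∀ i, Measurable (g i)) :
    ∫⁻ x : Fin n → ℝ, ∏ i, g i (x i) = ∏ i, ∫⁻ t, g i t := by
  induction n with
  | zero => simp [volume_pi]
  | succ n ih =>
    rw [← ((volume_preserving_piFinSuccAbove (fun _ : Fin (n + 1) => ℝ) 0).symm).lintegral_comp_emb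
      (MeasurableEquiv.measurableEmbedding _)]
    simp only [MeasurableEquiv.piFinSuccAbove_symm_apply, Fin.insertNthEquiv,
      Fin.prod_univ_succ, Fin.insertNth_zero, Equiv.coe_fn_mk, Fin.cons_succ, Fin.cons_zero,
      Fin.zero_succAbove, cast_eq]
    rw [Measure.volume_eq_prod, lintegral_prod_mul (f := g 0)
      (g := fun y : Fin n → ℝ => ∏ i, g i.succ (y i)) (hg 0).aemeasurable
      (Finset.measurable_prod _ fun i _ => (hg i.succ).comp (measurable_pi_apply i)).aemeasurable]
    rw [ih _ fun i => hg i.succ]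

theorem pi_withDensity {n : ℕ} {φ : ℝ → ℝ≥0∞} (hφ : Measurable φ)
    [SigmaFinite (volume.withDensity φ)] :
    Measure.pi (fun _ : Fin n => volume.withDensity φ) =
      (volume : Measure (Fin n → ℝ)).withDensity fun x => ∏ i, φ (x i) := by
  refine Measure.pi_eq fun s hs => ?_
  rw [withDensity_apply _ (MeasurableSet.univ_pi hs), ← lintegral_indicator
    (MeasurableSet.univ_pi hs)]
  have : ((Set.univ.pi s).indicator fun x : Fin n → ℝ => ∏ i, φ (x i)) =
      fun x => ∏ i, (s i).indicator φ (x i) := by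
    funext x
    by_cases hx : x ∈ Set.univ.pi s
    · rw [Set.indicator_of_mem hx]
      exact Finset.prod_congr rfl fun i _ => (Set.indicator_of_mem (hx i trivial) _).symm
    · rw [Set.indicator_of_notMem hx]
      obtain ⟨i, hi⟩ : ∃ i, x i ∉ s i := by simpa [Set.mem_pi] using hx
      exact (Finset.prod_eq_zero (Finset.mem_univ i) (Set.indicator_of_notMem hi _)).symm
  rw [this, lintegral_fin_prod _ fun i => hφ.indicator (hs i)]
  exact Finset.prod_congr rfl fun i _ => by
    rw [lintegral_indicator (hs i), withDensity_apply _ (hs i)]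

end ProductDensity

/-! ### Joint law of the mean and the relative dispersion. -/

section JointLaw

variable {Ω : Type*} [MeasurableSpace Ω] {P : Measure Ω} [IsProbabilityMeasure P] {k : ℕ}

/-- The unnormalised conditional weight, given that the mean is `m`, of the event that the relative
dispersion belongs to `D`, for a sample with density `φ`. -/
noncomputable def conditionalWeight (τ : (Fin (k + 1) → ℝ) → ℝ) (φ : ℝ → ℝ≥0∞) (D : Set ℝ)
    (m : ℝ) : ℝ≥0∞ :=
  ∫⁻ w in {w : Fin k → ℝ | τ (deviation w) ∈ D}, ∏ i, φ (m * (1 + deviation w i))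

theorem measurable_conditionalWeight (τ : (Fin (k + 1) → ℝ) → ℝ) {φ : ℝ → ℝ≥0∞}
    (hφ : Measurable φ) (D : Set ℝ) : Measurable (conditionalWeight τ φ D) := by
  have : Measurable fun y : ℝ × (Fin k → ℝ) => ∏ i, φ (y.1 * (1 + deviation y.2 i)) := by
    refine Finset.measurable_prod _ fun i _ => hφ.comp (measurable_fst.mul (measurable_const.add ?_))
    exact (measurable_pi_apply i).comp (continuous_deviation.measurable.comp measurable_snd)
  exact this.lintegral_prod_right'

/-- The substitution `u = m • w` produces the factor `m ^ k` and turns `τ(x)/m` into `τ (deviation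
w)`, which no longer involves `m`. -/
theorem exists_joint_law (τ : (Fin (k + 1) → ℝ) → ℝ) (hτ : IsDispersion τ)
    {φ : ℝ → ℝ≥0∞} (hφ : Measurable φ) (hφ0 : ∀ x, x < 0 → φ x = 0)
    {X : Fin (k + 1) → Ω → ℝ} (hXmeas : ∀ i, Measurable (X i)) (hXindep : iIndepFun X P)
    (hXlaw : ∀ i, P.map (X i) = volume.withDensity φ) :
    ∃ c : ℝ≥0∞, c ≠ 0 ∧ c ≠ ⊤ ∧ ∀ B D : Set ℝ, MeasurableSet B → MeasurableSet D →
      P ((fun ω => mean fun i => X i ω) ⁻¹' B ∩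
        (fun ω => τ (fun i => X i ω) / mean fun i => X i ω) ⁻¹' D) =
      c * ∫⁻ m in B, (Set.Ioi 0).indicator
        (fun m => ENNReal.ofReal (m ^ k) * conditionalWeight τ φ D m) m := by
  obtain ⟨c, hc, hc', hcH⟩ := exists_lintegral_eq_mul_lintegral_deviation k
  refine ⟨c, hc, hc', fun B D hB hD => ?_⟩
  have hprob : IsProbabilityMeasure (volume.withDensity φ) := by
    rw [← hXlaw 0]; exact Measure.isProbabilityMeasure_map (hXmeas 0).aemeasurable
  have hmap := (iIndepFun_iff_map_fun_eq_pi_map fun i => (hXmeas i).aemeasurable).mp hXindep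
  simp_rw [hXlaw] at hmap
  rw [pi_withDensity hφ] at hmap
  have hmean : Measurable (mean : (Fin (k + 1) → ℝ) → ℝ) := continuous_mean.measurable
  set S : Set (Fin (k + 1) → ℝ) := mean ⁻¹' B ∩ (fun x => τ x / mean x) ⁻¹' D with hS
  have hSm : MeasurableSet S :=
    (hmean hB).inter ((hτ.continuous.measurable.div hmean) hD)
  have hprod : Measurable fun x : Fin (k + 1) → ℝ => ∏ i, φ (x i) :=
    Finset.measurable_prod _ fun i _ => hφ.comp (measurable_pi_apply i)
  have h1 : P ((fun ω => mean fun i => X i ω) ⁻¹' B ∩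
        (fun ω => τ (fun i => X i ω) / mean fun i => X i ω) ⁻¹' D) =
      (Measure.map (fun ω i => X i ω) P) S :=
    (Measure.map_apply (measurable_pi_lambda _ hXmeas) hSm).symm
  rw [h1, hmap, withDensity_apply _ hSm, ← lintegral_indicator hSm,
    hcH _ (hprod.indicator hSm), ← lintegral_indicator hB]
  congr 1
  have hne : ∀ᵐ m : ℝ, m ≠ 0 := by simp [ae_iff]
  refine lintegral_congr_ae ?_
  filter_upwards [hne] with m hm
  rcases lt_or_gt_of_ne hm with hm | hm
  · have h0 : ∀ u : Fin k → ℝ, (∏ i, φ (m + deviation u i)) = 0 := by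
      intro u
      obtain ⟨i, hi⟩ : ∃ i, m + deviation u i < 0 := by
        by_contra! h
        have h2 := Finset.sum_nonneg fun i (_ : i ∈ Finset.univ) => h i
        simp only [Finset.sum_add_distrib, sum_deviation, Finset.sum_const, Finset.card_univ,
          Fintype.card_fin, nsmul_eq_mul, add_zero] at h2
        have : (0 : ℝ) < (k + 1 : ℕ) := by positivity
        nlinarith
      exact Finset.prod_eq_zero (Finset.mem_univ i) (hφ0 _ hi)
    have h3 : (Set.indicator B (fun m => (Set.Ioi (0 : ℝ)).indicator
        (fun m => ENNReal.ofReal (m ^ k) * conditionalWeight τ φ D m) m) m) = 0 := by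
      rw [Set.indicator_apply_eq_zero]
      intro _
      exact Set.indicator_of_notMem (by simpa using hm.le) _
    rw [h3, lintegral_eq_zero_iff']
    · filter_upwards with u
      exact Set.indicator_apply_eq_zero.mpr fun _ => h0 u
    · refine ((hprod.indicator hSm).comp ?_).aemeasurable
      exact (continuous_pi fun i =>
        continuous_const.add ((continuous_apply i).comp continuous_deviation)).measurable
  · have hfun (w : Fin k → ℝ) : (fun i => m + deviation (m • w) i) =
        fun i => m + m * deviation w i := by
      funext i; rw [deviation_smul]
    have hmem (w : Fin k → ℝ) : (fun i => m + deviation (m • w) i) ∈ S ↔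
        m ∈ B ∧ τ (deviation w) ∈ D := by
      rw [hS, Set.mem_inter_iff, Set.mem_preimage, Set.mem_preimage, mean_add_deviation,
        hfun, hτ.affine _ _ _ hm, mul_div_cancel_left₀ _ hm.ne']
    rw [lintegral_eq_pow_mul_lintegral_smul hm]
    by_cases hmB : m ∈ B
    · rw [Set.indicator_of_mem hmB, Set.indicator_of_mem (by exact hm), conditionalWeight,
        ← lintegral_indicator]
      · congr 1
        refine lintegral_congr fun w => ?_
        by_cases hw : τ (deviation w) ∈ D
        · rw [Set.indicator_of_mem ((hmem w).mpr ⟨hmB, hw⟩), Set.indicator_of_mem (by exact hw)]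
          refine Finset.prod_congr rfl fun i _ => ?_
          simp only [deviation_smul, mul_add, mul_one]
        · rw [Set.indicator_of_notMem fun h => hw ((hmem w).mp h).2,
            Set.indicator_of_notMem (by exact hw)]
      · exact (hτ.continuous.comp continuous_deviation).measurable hD
    · rw [Set.indicator_of_notMem hmB]
      simp only [mul_eq_zero]
      right
      rw [← lintegral_zero (μ := (volume : Measure (Fin k → ℝ)))]
      exact lintegral_congr fun w => Set.indicator_of_notMem (fun h => hmB ((hmem w).mp h).1) _

end JointLaw

/-! ### Gamma samples: the joint law factors. -/

section GammaSample

variable {Ω : Type*} [MeasurableSpace Ω] {P : Measure Ω} [IsProbabilityMeasure P] {k : ℕ}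

theorem gammaPDF_mul {a r m t : ℝ} (hm : 0 < m) :
    gammaPDF a r (m * t) = ENNReal.ofReal (m ^ (a - 1) * Real.exp (-(r * (m * t)))) *
      ENNReal.ofReal (if 0 ≤ t then r ^ a / Real.Gamma a * t ^ (a - 1) else 0) := by
  rw [gammaPDF_eq, ← ENNReal.ofReal_mul (by positivity)]
  congr 1
  by_cases ht : 0 ≤ t
  · rw [if_pos (by positivity), if_pos ht, Real.mul_rpow hm.le ht]
    ring
  · rw [if_neg (by push Not at ht ⊢; nlinarith), if_neg ht, mul_zero]

/-- Powers are multiplicative, and the exponentials combine into `exp (-r m (k + 1))` because the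
deviations sum to zero. -/
theorem exists_conditionalWeight_gammaPDF (τ : (Fin (k + 1) → ℝ) → ℝ) (a r : ℝ) :
    ∃ W : Set ℝ → ℝ≥0∞, ∀ D : Set ℝ, ∀ m : ℝ, 0 < m →
      conditionalWeight τ (gammaPDF a r) D m =
        ENNReal.ofReal ((m ^ (a - 1)) ^ (k + 1) * Real.exp (-(r * (m * (k + 1))))) * W D := by
  refine ⟨fun D => ∫⁻ w in {w : Fin k → ℝ | τ (deviation w) ∈ D}, ∏ i, ENNReal.ofReal
    (if 0 ≤ 1 + deviation w i then r ^ a / Real.Gamma a * (1 + deviation w i) ^ (a - 1) else 0),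
    fun D m hm => ?_⟩
  rw [conditionalWeight, ← lintegral_const_mul' _ _ ENNReal.ofReal_ne_top]
  refine lintegral_congr fun w => ?_
  simp_rw [gammaPDF_mul hm]
  rw [Finset.prod_mul_distrib, ← ENNReal.ofReal_prod_of_nonneg (fun i _ => by positivity),
    Finset.prod_mul_distrib, ← Real.exp_sum]
  simp [← Finset.mul_sum, Finset.sum_add_distrib]

theorem indepFun_mean_dispersion_of_gamma {τ : (Fin (k + 1) → ℝ) → ℝ} (hτ : IsDispersion τ)
    {X : Fin (k + 1) → Ω → ℝ} (hXmeas : ∀ i, Measurable (X i)) (hXindep : iIndepFun X P)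
    {a r : ℝ} (hXlaw : ∀ i, P.map (X i) = gammaMeasure a r) :
    IndepFun (fun ω => mean fun i => X i ω)
      (fun ω => τ (fun i => X i ω) / mean fun i => X i ω) P := by
  have hpdf : Measurable (gammaPDF a r) := (measurable_gammaPDFReal a r).ennreal_ofReal
  obtain ⟨c, -, -, hlaw⟩ := exists_joint_law τ hτ hpdf (fun x hx => gammaPDF_of_neg hx)
    hXmeas hXindep hXlaw
  obtain ⟨W, hW⟩ := exists_conditionalWeight_gammaPDF (k := k) τ a r
  set h : ℝ → ℝ≥0∞ := (Set.Ioi 0).indicator fun m => ENNReal.ofReal (m ^ k) *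
    ENNReal.ofReal ((m ^ (a - 1)) ^ (k + 1) * Real.exp (-(r * (m * (k + 1))))) with hh
  have hhm : Measurable h := by
    refine Measurable.indicator ?_ measurableSet_Ioi
    fun_prop
  have key (B D : Set ℝ) (hB : MeasurableSet B) (hD : MeasurableSet D) :
      P ((fun ω => mean fun i => X i ω) ⁻¹' B ∩
        (fun ω => τ (fun i => X i ω) / mean fun i => X i ω) ⁻¹' D) =
      (c * ∫⁻ m in B, h m) * W D := by
    rw [hlaw B D hB hD, mul_assoc, ← lintegral_mul_const _ hhm]
    congr 1
    refine lintegral_congr fun m => ?_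
    by_cases hm : m ∈ Set.Ioi (0 : ℝ)
    · rw [hh, Set.indicator_of_mem hm, Set.indicator_of_mem hm, hW D m hm, mul_assoc]
    · rw [hh, Set.indicator_of_notMem hm, Set.indicator_of_notMem hm, zero_mul]
  rw [indepFun_iff_measure_inter_preimage_eq_mul]
  intro B D hB hD
  have hone := key Set.univ Set.univ .univ .univ
  have hBu := key B Set.univ hB .univ
  have huD := key Set.univ D .univ hD
  simp only [Set.preimage_univ, Set.univ_inter, Set.inter_univ, measure_univ] at hone hBu huD
  rw [key B D hB hD, hBu, huD]
  -- The total mass `hone` supplies the normalisation of both marginals.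
  calc _ = (c * ∫⁻ m in B, h m) * W D * 1 := (mul_one _).symm
    _ = _ := by rw [hone]; ring

end GammaSample

/-! ### Second-order expansion at zero deviation. -/

section Taylor

theorem abs_log_one_add_sub_le {s : ℝ} (hs : |s| ≤ 1 / 2) :
    |Real.log (1 + s) - s + s ^ 2 / 2| ≤ 2 * |s| ^ 3 := by
  have h := Real.abs_log_sub_add_sum_range_le (x := -s) (by rw [abs_neg]; linarith) 2
  simp only [Finset.sum_range_succ, Finset.sum_range_zero, abs_neg, sub_neg_eq_add] at h
  norm_num at h
  have e : Real.log (1 + s) - s + s ^ 2 / 2 = -s + s ^ 2 / 2 + Real.log (1 + s) := by ring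
  rw [e]
  refine h.trans ?_
  rw [div_le_iff₀ (by linarith)]
  nlinarith [pow_nonneg (abs_nonneg s) 3]

theorem abs_sum_log_one_add_le {n : ℕ} {w : Fin n → ℝ} (hsum : ∑ i, w i = 0) {η : ℝ}
    (hw : ∀ i, |w i| ≤ 1 / 2) (hη : ∀ i, 2 * |w i| ≤ η) :
    |∑ i, Real.log (1 + w i) + (∑ i, w i ^ 2) / 2| ≤ η * ∑ i, w i ^ 2 := by
  have e : ∑ i, Real.log (1 + w i) + (∑ i, w i ^ 2) / 2 =
      ∑ i, (Real.log (1 + w i) - w i + w i ^ 2 / 2) := by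
    simp only [Finset.sum_add_distrib, Finset.sum_sub_distrib, hsum, Finset.sum_div]
    ring
  rw [e, Finset.mul_sum]
  refine (Finset.abs_sum_le_sum_abs _ _).trans (Finset.sum_le_sum fun i _ => ?_)
  refine (abs_log_one_add_sub_le (hw i)).trans ?_
  rw [← sq_abs (w i)]
  nlinarith [hη i, sq_nonneg |w i|]

/-- Zero sum removes the first-order term of the logarithms, so the exponent is `(lam / 2 - δ) S` up
to `o(S)`, with `S` the sum of squares. -/
theorem eventually_abs_exp_sum_log_sub_le {k : ℕ} (lam δ : ℝ) {η : ℝ} (hη : 0 < η) :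
    ∀ᶠ w : Fin k → ℝ in nhds 0,
      |Real.exp (-lam * ∑ i, Real.log (1 + deviation w i) - δ * ∑ i, deviation w i ^ 2) - 1 -
        (lam / 2 - δ) * ∑ i, deviation w i ^ 2| ≤ η * ∑ i, deviation w i ^ 2 := by
  -- The error budget `η` is split as `|lam| * θ` for the logarithms and `θ` for the quadratic
  -- remainder of `exp`.
  set θ := η / (|lam| + 1) with hθ
  have hθ0 : 0 < θ := by positivity
  have hθη : |lam| * θ + θ = η := by rw [hθ]; field_simp
  set C := |lam / 2 - δ| + |lam| * θ with hC
  have hC0 : 0 ≤ C := by positivity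
  have hcont (i : Fin (k + 1)) : Continuous fun w : Fin k → ℝ => deviation w i :=
    (continuous_apply i).comp continuous_deviation
  have hS : Continuous fun w : Fin k → ℝ => ∑ i, deviation w i ^ 2 :=
    continuous_finsetSum _ fun i _ => (hcont i).pow 2
  have h1 : ∀ᶠ w : Fin k → ℝ in nhds 0, ∀ i, |deviation w i| < min (1 / 2) (θ / 2) := by
    refine Filter.eventually_all.mpr fun i => ?_
    refine (hcont i).abs.continuousAt.eventually_lt continuousAt_const ?_
    simpa using hθ0
  have h2 : ∀ᶠ w : Fin k → ℝ in nhds 0, C * ∑ i, deviation w i ^ 2 < 1 := by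
    refine (continuous_const.mul hS).continuousAt.eventually_lt continuousAt_const ?_
    simp
  have h3 : ∀ᶠ w : Fin k → ℝ in nhds 0, C ^ 2 * ∑ i, deviation w i ^ 2 < θ := by
    refine (continuous_const.mul hS).continuousAt.eventually_lt continuousAt_const ?_
    simpa using hθ0
  filter_upwards [h1, h2, h3] with w h1 h2 h3
  have hlog := abs_sum_log_one_add_le (sum_deviation w) (η := θ)
    (fun i => (h1 i).le.trans (min_le_left _ _))
    (fun i => by have := (h1 i).le.trans (min_le_right _ _); linarith)
  set S := ∑ i, deviation w i ^ 2
  set T := ∑ i, Real.log (1 + deviation w i)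
  have hS0 : 0 ≤ S := Finset.sum_nonneg fun i _ => sq_nonneg _
  set y := -lam * T - δ * S
  have hy : |y - (lam / 2 - δ) * S| ≤ |lam| * θ * S := by
    have : y - (lam / 2 - δ) * S = -lam * (T + S / 2) := by ring
    rw [this, abs_mul, abs_neg, mul_assoc]
    exact mul_le_mul_of_nonneg_left hlog (abs_nonneg _)
  have hy2 : |y| ≤ C * S := by
    have : y = (lam / 2 - δ) * S + (y - (lam / 2 - δ) * S) := by ring
    rw [this]
    refine (abs_add_le _ _).trans ?_
    rw [abs_mul, abs_of_nonneg hS0, hC, add_mul]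
    linarith
  have hexp := Real.abs_exp_sub_one_sub_id_le (hy2.trans h2.le)
  have hy3 : y ^ 2 ≤ θ * S := by
    rw [← sq_abs]
    calc |y| ^ 2 ≤ (C * S) ^ 2 := by gcongr
      _ = C ^ 2 * S * S := by ring
      _ ≤ θ * S := by gcongr
  have : Real.exp y - 1 - (lam / 2 - δ) * S =
      (Real.exp y - 1 - y) + (y - (lam / 2 - δ) * S) := by ring
  rw [this]
  refine (abs_add_le _ _).trans ?_
  rw [← hθη, add_mul]
  linarith

end Taylor

/-! ### Convexity, touching parabolas and affine functions. -/

section Convexity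

/-- Where convexity fails, the graph rises above a chord. Subtracting the chord and adding a small
convex parabola that vanishes at its endpoints keeps a positive value inside, so the maximum is
interior. -/
theorem exists_isLocalMax_of_not_convexOn {g : ℝ → ℝ} (hg : ContinuousOn g (Set.Ioi 0))
    (h : ¬ ConvexOn ℝ (Set.Ioi 0) g) :
    ∃ m δ β : ℝ, 0 < m ∧ 0 < δ ∧ IsLocalMax (fun t => g t + δ * t ^ 2 + β * t) m := by
  have h2 : ∃ x y z : ℝ, 0 < x ∧ x < z ∧ z < y ∧
      g x * (y - z) + g y * (z - x) < g z * (y - x) := by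
    by_contra! h3
    refine h (LinearOrder.convexOn_of_lt (convex_Ioi 0) ?_)
    intro x hx y hy hxy a b ha hb hab
    obtain rfl : a = 1 - b := by linarith
    have h4 := h3 x y ((1 - b) * x + b * y) hx (by nlinarith) (by nlinarith)
    simp only [smul_eq_mul]
    have : 0 < y - x := by linarith
    refine le_of_mul_le_mul_right ?_ this
    nlinarith
  obtain ⟨x, y, z, hx, hxz, hzy, hlt⟩ := h2
  have hyx : 0 < y - x := by linarith
  set s := (g y - g x) / (y - x) with hs
  -- The parabola then costs exactly half of the gap at `z`.
  set δ := (g z - (g x + s * (z - x))) / (2 * ((z - x) * (y - z))) with hδ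
  have hgap : 0 < g z - (g x + s * (z - x)) := by
    have : g z - (g x + s * (z - x)) =
        (g z * (y - x) - (g x * (y - z) + g y * (z - x))) / (y - x) := by
      rw [hs]; field_simp; ring
    rw [this]
    exact div_pos (by linarith) hyx
  have hδ0 : 0 < δ := by
    have : 0 < (z - x) * (y - z) := mul_pos (by linarith) (by linarith)
    positivity
  set G : ℝ → ℝ := fun t => g t - (g x + s * (t - x)) + δ * ((t - x) * (t - y)) with hG
  have hGx : G x = 0 := by simp [hG]
  have hGy : G y = 0 := by
    have : s * (y - x) = g y - g x := by rw [hs]; field_simp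
    simp [hG, this]
  have hGz : 0 < G z := by
    have h5 : δ * (2 * ((z - x) * (y - z))) = g z - (g x + s * (z - x)) := by
      rw [hδ]
      refine div_mul_cancel₀ _ ?_
      have : 0 < (z - x) * (y - z) := mul_pos (by linarith) (by linarith)
      positivity
    simp only [hG]
    nlinarith
  have hsub : Set.Icc x y ⊆ Set.Ioi 0 := fun t ht => lt_of_lt_of_le hx ht.1
  have hGc : ContinuousOn G (Set.Icc x y) :=
    ((hg.mono hsub).sub (by fun_prop)).add (by fun_prop)
  obtain ⟨m, hm, hmax⟩ := isCompact_Icc.exists_isMaxOn ⟨x, Set.left_mem_Icc.mpr (by linarith)⟩ hGc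
  have hGm : 0 < G m := hGz.trans_le (hmax ⟨hxz.le, hzy.le⟩)
  have hmx : x < m := lt_of_le_of_ne hm.1 fun e => by rw [← e, hGx] at hGm; exact hGm.false
  have hmy : m < y := lt_of_le_of_ne hm.2 fun e => by rw [e, hGy] at hGm; exact hGm.false
  -- The third witness is the coefficient of `t` in `G t - g t`; constants do not affect a local
  -- maximum.
  refine ⟨m, δ, -s - δ * (x + y), hx.trans hmx, hδ0, ?_⟩
  have hloc := hmax.isLocalMax (Icc_mem_nhds hmx hmy)
  filter_upwards [hloc] with t ht
  simp only [hG] at ht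
  nlinarith

theorem exists_isLocalMin_of_not_concaveOn {g : ℝ → ℝ} (hg : ContinuousOn g (Set.Ioi 0))
    (h : ¬ ConcaveOn ℝ (Set.Ioi 0) g) :
    ∃ m δ β : ℝ, 0 < m ∧ 0 < δ ∧ IsLocalMin (fun t => g t - δ * t ^ 2 + β * t) m := by
  obtain ⟨m, δ, β, hm, hδ, hloc⟩ := exists_isLocalMax_of_not_convexOn (g := fun t => -g t) hg.neg
    fun hc => h (neg_convexOn_iff.mp hc)
  refine ⟨m, δ, -β, hm, hδ, ?_⟩
  filter_upwards [hloc] with t ht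
  linarith

theorem exists_affine_of_convexOn_of_concaveOn {g : ℝ → ℝ} (h₁ : ConvexOn ℝ (Set.Ioi 0) g)
    (h₂ : ConcaveOn ℝ (Set.Ioi 0) g) : ∃ c d : ℝ, ∀ x, 0 < x → g x = c * x + d := by
  have key (x y z : ℝ) (hx : 0 < x) (hxy : x < y) (hyz : y < z) :
      (g y - g x) * (z - y) = (g z - g y) * (y - x) := by
    have a₁ := h₁.slope_mono_adjacent (Set.mem_Ioi.mpr hx)
      (Set.mem_Ioi.mpr (by linarith : 0 < z)) hxy hyz
    have a₂ := h₂.slope_anti_adjacent (Set.mem_Ioi.mpr hx)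
      (Set.mem_Ioi.mpr (by linarith : 0 < z)) hxy hyz
    have hxy' : y - x ≠ 0 := by linarith
    have hyz' : z - y ≠ 0 := by linarith
    have := le_antisymm a₁ a₂
    field_simp at this
    linarith
  refine ⟨g 2 - g 1, 2 * g 1 - g 2, fun x hx => ?_⟩
  rcases lt_trichotomy x 1 with h | rfl | h
  · have := key x 1 2 hx h (by norm_num); linarith
  · ring
  · rcases lt_trichotomy x 2 with h' | rfl | h'
    · have := key 1 x 2 one_pos h h'; linarith
    · ring
    · have := key 1 2 x one_pos (by norm_num) h'; linarith

/-- The values of `lam` giving convexity and those giving concavity form two closed sets covering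
the line. Both are nonempty, so they meet, and a function both convex and concave is affine. -/
theorem exists_eq_log_add_affine {l : ℝ → ℝ}
    (h : ∀ lam : ℝ, ConvexOn ℝ (Set.Ioi 0) (fun t => l t + lam * Real.log t) ∨
      ConcaveOn ℝ (Set.Ioi 0) (fun t => l t + lam * Real.log t)) :
    ∃ lam c d : ℝ, ∀ x, 0 < x → l x = lam * Real.log x + c * x + d := by
  have hclosed (x y a b : ℝ) : Continuous fun lam : ℝ =>
      a * (l x + lam * Real.log x) + b * (l y + lam * Real.log y) -
        (l (a * x + b * y) + lam * Real.log (a * x + b * y)) := by fun_prop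
  have hA : IsClosed {lam : ℝ | ConvexOn ℝ (Set.Ioi 0) fun t => l t + lam * Real.log t} := by
    have : {lam : ℝ | ConvexOn ℝ (Set.Ioi 0) fun t => l t + lam * Real.log t} =
        ⋂ (x : ℝ) (_ : 0 < x) (y : ℝ) (_ : 0 < y) (a : ℝ) (b : ℝ) (_ : 0 ≤ a) (_ : 0 ≤ b)
          (_ : a + b = 1), {lam : ℝ | 0 ≤ a * (l x + lam * Real.log x) +
            b * (l y + lam * Real.log y) -
            (l (a * x + b * y) + lam * Real.log (a * x + b * y))} := by
      ext lam
      simp only [ConvexOn, convex_Ioi, true_and, Set.mem_iInter, Set.mem_ofPred_eq, smul_eq_mul,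
        Set.mem_Ioi, sub_nonneg]
    rw [this]
    refine isClosed_iInter fun x => isClosed_iInter fun _ => isClosed_iInter fun y =>
      isClosed_iInter fun _ => isClosed_iInter fun a => isClosed_iInter fun b =>
      isClosed_iInter fun _ => isClosed_iInter fun _ => isClosed_iInter fun _ =>
      isClosed_le continuous_const (hclosed x y a b)
  have hB : IsClosed {lam : ℝ | ConcaveOn ℝ (Set.Ioi 0) fun t => l t + lam * Real.log t} := by
    have : {lam : ℝ | ConcaveOn ℝ (Set.Ioi 0) fun t => l t + lam * Real.log t} =
        ⋂ (x : ℝ) (_ : 0 < x) (y : ℝ) (_ : 0 < y) (a : ℝ) (b : ℝ) (_ : 0 ≤ a) (_ : 0 ≤ b)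
          (_ : a + b = 1), {lam : ℝ | a * (l x + lam * Real.log x) +
            b * (l y + lam * Real.log y) -
            (l (a * x + b * y) + lam * Real.log (a * x + b * y)) ≤ 0} := by
      ext lam
      simp only [ConcaveOn, convex_Ioi, true_and, Set.mem_iInter, Set.mem_ofPred_eq, smul_eq_mul,
        Set.mem_Ioi, sub_nonpos]
    rw [this]
    refine isClosed_iInter fun x => isClosed_iInter fun _ => isClosed_iInter fun y =>
      isClosed_iInter fun _ => isClosed_iInter fun a => isClosed_iInter fun b =>
      isClosed_iInter fun _ => isClosed_iInter fun _ => isClosed_iInter fun _ =>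
      isClosed_le (hclosed x y a b) continuous_const
  have hlog : 0 < 2 * Real.log 2 - Real.log 3 := by
    have h4 : 2 * Real.log 2 = Real.log 4 := by
      rw [show (4 : ℝ) = 2 ^ 2 by norm_num, Real.log_pow]; norm_num
    rw [h4, sub_pos]
    exact Real.log_lt_log (by norm_num) (by norm_num)
  -- Second difference at `1, 2, 3`: that of `log` is strictly negative, so large `lam` excludes
  -- convexity and very negative `lam` excludes concavity.
  set G := l 1 + l 3 - 2 * l 2 with hG
  have hvex (lam : ℝ) (hl : ConvexOn ℝ (Set.Ioi 0) fun t => l t + lam * Real.log t) :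
      lam * (2 * Real.log 2 - Real.log 3) ≤ G := by
    have := hl.2 (Set.mem_Ioi.mpr one_pos) (Set.mem_Ioi.mpr (by norm_num : (0 : ℝ) < 3))
      (by norm_num : (0 : ℝ) ≤ 1 / 2) (by norm_num : (0 : ℝ) ≤ 1 / 2) (by norm_num)
    simp only [smul_eq_mul, Real.log_one] at this
    norm_num at this
    linarith
  have hcave (lam : ℝ) (hl : ConcaveOn ℝ (Set.Ioi 0) fun t => l t + lam * Real.log t) :
      G ≤ lam * (2 * Real.log 2 - Real.log 3) := by
    have := hl.2 (Set.mem_Ioi.mpr one_pos) (Set.mem_Ioi.mpr (by norm_num : (0 : ℝ) < 3))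
      (by norm_num : (0 : ℝ) ≤ 1 / 2) (by norm_num : (0 : ℝ) ≤ 1 / 2) (by norm_num)
    simp only [smul_eq_mul, Real.log_one] at this
    norm_num at this
    linarith
  obtain ⟨lam, -, hl₁, hl₂⟩ := isPreconnected_closed_iff.mp isPreconnected_univ _ _ hA hB
    (fun lam _ => h lam)
    ⟨(G - 1) / (2 * Real.log 2 - Real.log 3), trivial, (h _).resolve_right fun hc => by
      have := hcave _ hc
      rw [div_mul_cancel₀ _ hlog.ne'] at this
      linarith⟩
    ⟨(G + 1) / (2 * Real.log 2 - Real.log 3), trivial, (h _).resolve_left fun hc => by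
      have := hvex _ hc
      rw [div_mul_cancel₀ _ hlog.ne'] at this
      linarith⟩
  rw [Set.mem_ofPred_eq] at hl₁ hl₂
  obtain ⟨c, d, hcd⟩ := exists_affine_of_convexOn_of_concaveOn hl₁ hl₂
  exact ⟨-lam, c, d, fun x hx => by have := hcd x hx; linarith⟩

end Convexity

/-! ### Sample weight of small relative dispersions. -/

section LocalWeight

variable {k : ℕ}

/-- The deviations of dispersion at most `ε`. -/
def deviationBall (τ : (Fin (k + 1) → ℝ) → ℝ) (ε : ℝ) : Set (Fin k → ℝ) :=
  {w | τ (deviation w) ≤ ε}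

/-- The integral of the sample density `∏ f(xᵢ)` over relative deviations from the mean `m` of
dispersion at most `ε`. -/
noncomputable def localWeight (τ : (Fin (k + 1) → ℝ) → ℝ) (f : ℝ → ℝ) (ε m : ℝ) : ℝ :=
  ∫ w in deviationBall τ ε, ∏ i, f (m * (1 + deviation w i))

theorem continuous_deviation_apply (i : Fin (k + 1)) :
    Continuous fun w : Fin k → ℝ => deviation w i :=
  (continuous_apply i).comp continuous_deviation

variable {τ : (Fin (k + 1) → ℝ) → ℝ}

theorem IsDispersion.exists_abs_deviation_le (hτ : IsDispersion τ) :
    ∃ M : ℝ, 0 < M ∧ ∀ ε, ∀ w ∈ deviationBall τ ε, ∀ i, |deviation w i| ≤ M * ε := by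
  obtain ⟨M, hM, h⟩ := hτ.bound
  refine ⟨M, hM, fun ε w hw i => ?_⟩
  have h0 : mean (deviation w) = 0 := by simp [mean]
  have := h (deviation w) i
  rw [h0, sub_zero] at this
  exact this.trans (mul_le_mul_of_nonneg_left hw hM.le)

theorem IsDispersion.isClosed_deviationBall (hτ : IsDispersion τ) (ε : ℝ) :
    IsClosed (deviationBall τ ε) :=
  isClosed_le (hτ.continuous.comp continuous_deviation) continuous_const

theorem IsDispersion.isCompact_deviationBall (hτ : IsDispersion τ) (ε : ℝ) :
    IsCompact (deviationBall τ ε) := by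
  obtain ⟨M, hM, h⟩ := hτ.exists_abs_deviation_le
  refine Metric.isCompact_of_isClosed_isBounded (hτ.isClosed_deviationBall ε)
    ((Metric.isBounded_closedBall (x := 0) (r := |M * ε|)).subset fun w hw => ?_)
  rw [mem_closedBall_zero_iff, pi_norm_le_iff_of_nonneg (abs_nonneg _)]
  intro j
  have := h ε w hw j.succ
  rw [deviation_succ] at this
  exact this.trans (le_abs_self _)

theorem IsDispersion.zero (hτ : IsDispersion τ) : τ 0 = 0 := by
  have h := hτ.affine 0 2 0 two_pos
  have h0 : (fun i => (0 : ℝ) + 2 * (0 : Fin (k + 1) → ℝ) i) = 0 := by funext i; simp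
  rw [h0] at h
  linarith

theorem IsDispersion.deviationBall_mem_nhds (hτ : IsDispersion τ) {ε : ℝ} (hε : 0 < ε) :
    deviationBall τ ε ∈ 𝓝 0 := by
  have : ∀ᶠ w : Fin k → ℝ in 𝓝 0, τ (deviation w) < ε := by
    refine (hτ.continuous.comp continuous_deviation).continuousAt.eventually_lt
      continuousAt_const ?_
    simpa [hτ.zero] using hε
  filter_upwards [this] with w hw using hw.le

theorem IsDispersion.measureReal_deviationBall_pos (hτ : IsDispersion τ) {ε : ℝ} (hε : 0 < ε) :
    0 < volume.real (deviationBall τ ε) :=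
  ENNReal.toReal_pos (Measure.measure_pos_of_mem_nhds _ (hτ.deviationBall_mem_nhds hε)).ne'
    (hτ.isCompact_deviationBall ε).measure_ne_top

theorem IsDispersion.eventually_deviationBall_subset (hτ : IsDispersion τ) {U : Set (Fin k → ℝ)}
    (hU : U ∈ 𝓝 0) : ∀ᶠ ε in 𝓝[>] (0 : ℝ), deviationBall τ ε ⊆ U := by
  obtain ⟨M, hM, h⟩ := hτ.exists_abs_deviation_le
  obtain ⟨ρ, hρ, hρU⟩ := Metric.mem_nhds_iff.mp hU
  have : ∀ᶠ ε in 𝓝[>] (0 : ℝ), ε < ρ / M :=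
    mem_nhdsWithin_of_mem_nhds (Iio_mem_nhds (by positivity))
  filter_upwards [this] with ε hε w hw
  refine hρU ?_
  rw [mem_ball_zero_iff, pi_norm_lt_iff hρ]
  intro j
  have h1 := h ε w hw j.succ
  rw [deviation_succ] at h1
  rw [lt_div_iff₀ hM] at hε
  exact h1.trans_lt (by linarith)

/-- This keeps all sample points at least `m / 2`, away from `0`, where `f` may be unbounded. -/
theorem IsDispersion.exists_pos_half_le (hτ : IsDispersion τ) :
    ∃ ε₀ : ℝ, 0 < ε₀ ∧ ∀ ε ≤ ε₀, ∀ w ∈ deviationBall τ ε, ∀ i, 1 / 2 ≤ 1 + deviation w i := by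
  obtain ⟨M, hM, h⟩ := hτ.exists_abs_deviation_le
  refine ⟨1 / (2 * M), by positivity, fun ε hε w hw i => ?_⟩
  have h1 := abs_le.mp (h ε w hw i)
  rw [le_div_iff₀ (by positivity)] at hε
  linarith [h1.1]

variable {f : ℝ → ℝ}

/-- Truncation at `1 / 2` makes the integrand continuous for all `w`, as parametric integration
requires, without changing it on small deviation balls. -/
theorem continuous_prod_max (hf : ContinuousOn f (Set.Ioi 0)) :
    Continuous (Function.uncurry fun (m : Set.Ioi (0 : ℝ)) (w : Fin k → ℝ) =>
      ∏ i, f (m * max (1 / 2) (1 + deviation w i))) := by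
  refine continuous_finsetProd _ fun i _ => ?_
  refine hf.comp_continuous ?_ ?_
  · exact (continuous_subtype_val.comp continuous_fst).mul (continuous_const.max
      (continuous_const.add ((continuous_deviation_apply i).comp continuous_snd)))
  · rintro ⟨⟨m, hm⟩, w⟩
    exact mul_pos (Set.mem_Ioi.mp hm) (lt_max_of_lt_left (by norm_num))

theorem prod_eq_prod_max {ε₀ : ℝ}
    (hε₀ : ∀ ε ≤ ε₀, ∀ w ∈ deviationBall τ ε, ∀ i, 1 / 2 ≤ 1 + deviation w i)
    {ε : ℝ} (hε : ε ≤ ε₀) (m : ℝ) {w : Fin k → ℝ}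
    (hw : w ∈ deviationBall τ ε) :
    ∏ i, f (m * (1 + deviation w i)) = ∏ i, f (m * max (1 / 2) (1 + deviation w i)) :=
  Finset.prod_congr rfl fun i _ => by rw [max_eq_right (hε₀ ε hε w hw i)]

theorem continuousOn_prod {ε₀ : ℝ}
    (hε₀ : ∀ ε ≤ ε₀, ∀ w ∈ deviationBall τ ε, ∀ i, 1 / 2 ≤ 1 + deviation w i)
    {ε : ℝ} (hε : ε ≤ ε₀) (hf : ContinuousOn f (Set.Ioi 0)) {m : ℝ}
    (hm : 0 < m) :
    ContinuousOn (fun w : Fin k → ℝ => ∏ i, f (m * (1 + deviation w i))) (deviationBall τ ε) := by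
  refine ContinuousOn.congr (Continuous.continuousOn ?_) fun w hw => prod_eq_prod_max hε₀ hε m hw
  exact (continuous_prod_max hf).comp (Continuous.prodMk_right (⟨m, hm⟩ : Set.Ioi (0 : ℝ)))

theorem integrableOn_prod {ε₀ : ℝ}
    (hε₀ : ∀ ε ≤ ε₀, ∀ w ∈ deviationBall τ ε, ∀ i, 1 / 2 ≤ 1 + deviation w i)
    (hτ : IsDispersion τ) {ε : ℝ} (hε : ε ≤ ε₀)
    (hf : ContinuousOn f (Set.Ioi 0)) {m : ℝ} (hm : 0 < m) :
    IntegrableOn (fun w : Fin k → ℝ => ∏ i, f (m * (1 + deviation w i))) (deviationBall τ ε) :=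
  (continuousOn_prod hε₀ hε hf hm).integrableOn_compact (hτ.isCompact_deviationBall ε)

theorem continuousOn_localWeight {ε₀ : ℝ}
    (hε₀ : ∀ ε ≤ ε₀, ∀ w ∈ deviationBall τ ε, ∀ i, 1 / 2 ≤ 1 + deviation w i)
    (hτ : IsDispersion τ) {ε : ℝ} (hε : ε ≤ ε₀)
    (hf : ContinuousOn f (Set.Ioi 0)) : ContinuousOn (localWeight τ f ε) (Set.Ioi 0) := by
  rw [continuousOn_iff_continuous_domRestrict]
  have : LocallyCompactSpace (Set.Ioi (0 : ℝ)) := isOpen_Ioi.locallyCompactSpace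
  have := continuous_parametric_integral_of_continuous
    (μ := (volume : Measure (Fin k → ℝ))) (continuous_prod_max (k := k) hf)
    (hτ.isCompact_deviationBall ε)
  refine this.congr fun m => ?_
  exact setIntegral_congr_fun (hτ.isClosed_deviationBall ε).measurableSet fun w hw =>
    (prod_eq_prod_max hε₀ hε m.1 hw).symm

theorem prod_pos_of_mem_deviationBall {ε₀ : ℝ}
    (hε₀ : ∀ ε ≤ ε₀, ∀ w ∈ deviationBall τ ε, ∀ i, 1 / 2 ≤ 1 + deviation w i)
    {ε : ℝ} (hε : ε ≤ ε₀) (hpos : ∀ x, 0 < x → 0 < f x) {m : ℝ}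
    (hm : 0 < m) {w : Fin k → ℝ} (hw : w ∈ deviationBall τ ε) :
    0 < ∏ i, f (m * (1 + deviation w i)) :=
  Finset.prod_pos fun i _ => hpos _ (mul_pos hm (by linarith [hε₀ ε hε w hw i]))

theorem localWeight_pos {ε₀ : ℝ}
    (hε₀ : ∀ ε ≤ ε₀, ∀ w ∈ deviationBall τ ε, ∀ i, 1 / 2 ≤ 1 + deviation w i)
    (hτ : IsDispersion τ) {ε : ℝ} (hε0 : 0 < ε) (hε : ε ≤ ε₀)
    (hf : ContinuousOn f (Set.Ioi 0)) (hpos : ∀ x, 0 < x → 0 < f x) {m : ℝ} (hm : 0 < m) :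
    0 < localWeight τ f ε m := by
  have hK := (hτ.isClosed_deviationBall ε).measurableSet
  rw [localWeight, setIntegral_pos_iff_support_of_nonneg_ae
    ((ae_restrict_iff' hK).mpr (.of_forall fun w hw =>
      (prod_pos_of_mem_deviationBall hε₀ hε hpos hm hw).le))
    (integrableOn_prod hε₀ hτ hε hf hm)]
  have hsub : deviationBall τ ε ⊆
      Function.support fun w : Fin k → ℝ => ∏ i, f (m * (1 + deviation w i)) :=
    fun w hw => (prod_pos_of_mem_deviationBall hε₀ hε hpos hm hw).ne'
  rw [Set.inter_eq_right.mpr hsub]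
  exact Measure.measure_pos_of_mem_nhds _ (hτ.deviationBall_mem_nhds hε0)

theorem conditionalWeight_Iic_eq {ε₀ : ℝ}
    (hε₀ : ∀ ε ≤ ε₀, ∀ w ∈ deviationBall τ ε, ∀ i, 1 / 2 ≤ 1 + deviation w i)
    (hτ : IsDispersion τ) {ε : ℝ} (hε : ε ≤ ε₀)
    (hf : ContinuousOn f (Set.Ioi 0)) (hpos : ∀ x, 0 < x → 0 < f x) {m : ℝ} (hm : 0 < m) :
    conditionalWeight τ ((Set.Ioi 0).indicator fun x => ENNReal.ofReal (f x)) (Set.Iic ε) m =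
      ENNReal.ofReal (localWeight τ f ε m) := by
  have hK := (hτ.isClosed_deviationBall ε).measurableSet
  rw [localWeight, ofReal_integral_eq_lintegral_ofReal (integrableOn_prod hε₀ hτ hε hf hm)
    ((ae_restrict_iff' hK).mpr (.of_forall fun w hw =>
      (prod_pos_of_mem_deviationBall hε₀ hε hpos hm hw).le))]
  refine setLIntegral_congr_fun hK fun w hw => ?_
  have h1 (i : Fin (k + 1)) : 0 < m * (1 + deviation w i) :=
    mul_pos hm (by linarith [hε₀ ε hε w hw i])
  change _ = ENNReal.ofReal (∏ i, f (m * (1 + deviation w i)))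
  rw [ENNReal.ofReal_prod_of_nonneg fun i _ => (hpos _ (h1 i)).le]
  exact Finset.prod_congr rfl fun i _ => Set.indicator_of_mem (Set.mem_Ioi.mpr (h1 i)) _

end LocalWeight

/-! ### Limit of the normalised weight. -/

section Limits

variable {k : ℕ} {τ : (Fin (k + 1) → ℝ) → ℝ} {f : ℝ → ℝ}

/-- An average over sets shrinking to `0` of a function continuous there. -/
theorem tendsto_localWeight_div (hτ : IsDispersion τ) (hf : ContinuousOn f (Set.Ioi 0)) {m : ℝ}
    (hm : 0 < m) :
    Filter.Tendsto (fun ε => localWeight τ f ε m / volume.real (deviationBall τ ε)) (𝓝[>] 0)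
      (𝓝 (f m ^ (k + 1))) := by
  obtain ⟨ε₀, hε₀, h₀⟩ := hτ.exists_pos_half_le
  have hcont : ContinuousAt (fun w : Fin k → ℝ => ∏ i, f (m * (1 + deviation w i))) 0 := by
    refine (continuousOn_prod h₀ le_rfl hf hm).continuousAt (hτ.deviationBall_mem_nhds hε₀)
  rw [Metric.tendsto_nhds]
  intro η hη
  have hU : ∀ᶠ w : Fin k → ℝ in 𝓝 0,
      ‖(∏ i, f (m * (1 + deviation w i))) - f m ^ (k + 1)‖ < η / 2 := by
    have := Metric.tendsto_nhds.mp hcont (η / 2) (by positivity)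
    simpa [dist_eq_norm] using this
  filter_upwards [hτ.eventually_deviationBall_subset hU, self_mem_nhdsWithin,
    mem_nhdsWithin_of_mem_nhds (Iio_mem_nhds hε₀)] with ε hsub hε0 hε
  have hV := hτ.measureReal_deviationBall_pos hε0
  have hfin := (hτ.isCompact_deviationBall ε).measure_lt_top (μ := volume)
  have h1 : localWeight τ f ε m - f m ^ (k + 1) * volume.real (deviationBall τ ε) =
      ∫ w in deviationBall τ ε, ((∏ i, f (m * (1 + deviation w i))) - f m ^ (k + 1)) := by
    rw [integral_sub (integrableOn_prod h₀ hτ (le_of_lt hε) hf hm)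
      (integrableOn_const hfin.ne), setIntegral_const, smul_eq_mul, mul_comm (volume.real _)]
    rfl
  have h2 := norm_setIntegral_le_of_norm_le_const (C := η / 2) hfin
    (f := fun w => (∏ i, f (m * (1 + deviation w i))) - f m ^ (k + 1))
    (fun w hw => le_of_lt (hsub hw))
  rw [← h1, Real.norm_eq_abs] at h2
  rw [Real.dist_eq, div_sub' hV.ne', abs_div, abs_of_pos hV, div_lt_iff₀ hV, mul_comm (volume.real _)]
  exact h2.trans_lt (by nlinarith)

end Limits

/-! ### Consequences of independence. -/

section Independence

variable {Ω : Type*} [MeasurableSpace Ω] {P : Measure Ω} [IsProbabilityMeasure P] {k : ℕ}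
  {τ : (Fin (k + 1) → ℝ) → ℝ} {f : ℝ → ℝ}

theorem measurable_indicator_ofReal (hf : ContinuousOn f (Set.Ioi 0)) :
    Measurable ((Set.Ioi 0).indicator fun x => ENNReal.ofReal (f x)) := by
  have h : Measurable ((Set.Ioi (0 : ℝ)).piecewise f 0) :=
    hf.measurable_piecewise continuousOn_const measurableSet_Ioi
  convert h.ennreal_ofReal.indicator (measurableSet_Ioi (a := (0 : ℝ))) using 1
  funext x
  by_cases hx : x ∈ Set.Ioi (0 : ℝ)
  · rw [Set.indicator_of_mem hx, Set.indicator_of_mem hx, Set.piecewise_eq_of_mem _ _ _ hx]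
  · rw [Set.indicator_of_notMem hx, Set.indicator_of_notMem hx]

/-- With `ρ ε` the probability that the relative dispersion is at most `ε`, independence gives `ρ ε'
* g ε` and `ρ ε * g ε'` the same integral over every Borel set. They agree almost everywhere, and
continuity in `m` makes the identity hold everywhere. -/
theorem exists_pos_localWeight_proportional (hτ : IsDispersion τ)
    (hf : ContinuousOn f (Set.Ioi 0)) (hpos : ∀ x, 0 < x → 0 < f x)
    {X : Fin (k + 1) → Ω → ℝ} (hXmeas : ∀ i, Measurable (X i)) (hXindep : iIndepFun X P)
    (hXlaw : ∀ i, P.map (X i) =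
      volume.withDensity ((Set.Ioi 0).indicator fun x => ENNReal.ofReal (f x)))
    (hind : IndepFun (fun ω => mean fun i => X i ω)
      (fun ω => τ (fun i => X i ω) / mean fun i => X i ω) P) :
    ∃ ε₀ : ℝ, 0 < ε₀ ∧ ∃ ρ : ℝ → ℝ, (∀ ε, 0 < ε → ε ≤ ε₀ → 0 < ρ ε) ∧
      ∀ ε ε' m, 0 < ε → ε ≤ ε₀ → 0 < ε' → ε' ≤ ε₀ → 0 < m →
        ρ ε' * localWeight τ f ε m = ρ ε * localWeight τ f ε' m := by
  obtain ⟨ε₀, hε₀, h₀⟩ := hτ.exists_pos_half_le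
  set φ := (Set.Ioi (0 : ℝ)).indicator fun x => ENNReal.ofReal (f x) with hφ
  have hφm : Measurable φ := measurable_indicator_ofReal hf
  obtain ⟨c, hc, hc', hlaw⟩ := exists_joint_law τ hτ hφm
    (fun x hx => Set.indicator_of_notMem (by simpa using hx.le) _) hXmeas hXindep hXlaw
  set R : Ω → ℝ := fun ω => τ (fun i => X i ω) / mean fun i => X i ω
  set A : Ω → ℝ := fun ω => mean fun i => X i ω
  set g : ℝ → ℝ → ℝ≥0∞ := fun ε => (Set.Ioi 0).indicator fun m =>
    ENNReal.ofReal (m ^ k) * conditionalWeight τ φ (Set.Iic ε) m with hg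
  have hgm (ε : ℝ) : Measurable (g ε) := by
    refine Measurable.indicator (Measurable.mul ?_ (measurable_conditionalWeight τ hφm _))
      measurableSet_Ioi
    fun_prop
  have hgv {ε m : ℝ} (hε : ε ≤ ε₀) (hm : 0 < m) :
      g ε m = ENNReal.ofReal (m ^ k * localWeight τ f ε m) := by
    rw [ENNReal.ofReal_mul (by positivity)]
    simp only [hg]
    rw [Set.indicator_of_mem (Set.mem_Ioi.mpr hm), conditionalWeight_Iic_eq h₀ hτ hε hf hpos hm]
  have hlaw' (B : Set ℝ) (hB : MeasurableSet B) (ε : ℝ) :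
      c * ∫⁻ m in B, g ε m = P (A ⁻¹' B) * P (R ⁻¹' Set.Iic ε) := by
    rw [← hlaw B _ hB measurableSet_Iic]
    exact (indepFun_iff_measure_inter_preimage_eq_mul.mp hind) B _ hB measurableSet_Iic
  have hρpos (ε : ℝ) (hε0 : 0 < ε) (hε : ε ≤ ε₀) : 0 < P (R ⁻¹' Set.Iic ε) := by
    have h1 := hlaw' Set.univ .univ ε
    simp only [Set.preimage_univ, measure_univ, one_mul, Measure.restrict_univ] at h1
    rw [← h1]
    refine ENNReal.mul_pos hc ?_
    rw [← pos_iff_ne_zero, lintegral_pos_iff_support (hgm ε)]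
    have : Set.Ioi (0 : ℝ) ⊆ Function.support (g ε) := by
      intro m hm
      rw [Function.mem_support, hgv hε hm, ← pos_iff_ne_zero, ENNReal.ofReal_pos]
      exact mul_pos (pow_pos hm _) (localWeight_pos h₀ hτ hε0 hε hf hpos hm)
    refine lt_of_lt_of_le ?_ (measure_mono this)
    simp
  refine ⟨ε₀, hε₀, fun ε => P.real (R ⁻¹' Set.Iic ε), fun ε h h' =>
    ENNReal.toReal_pos (hρpos ε h h').ne' (measure_ne_top _ _), ?_⟩
  intro ε ε' m hε0 hε hε'0 hε' hm
  have hae : (fun m => P (R ⁻¹' Set.Iic ε') * g ε m) =ᵐ[volume]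
      fun m => P (R ⁻¹' Set.Iic ε) * g ε' m := by
    refine ae_eq_of_forall_setLIntegral_eq_of_sigmaFinite ((hgm ε).const_mul _)
      ((hgm ε').const_mul _) fun B hB _ => ?_
    rw [lintegral_const_mul _ (hgm ε), lintegral_const_mul _ (hgm ε')]
    refine (ENNReal.mul_right_inj hc hc').mp ?_
    rw [mul_left_comm, hlaw' B hB, mul_left_comm c, hlaw' B hB]
    ring
  have hae' : (fun m => P.real (R ⁻¹' Set.Iic ε') * localWeight τ f ε m)
      =ᵐ[volume.restrict (Set.Ioi 0)]
      fun m => P.real (R ⁻¹' Set.Iic ε) * localWeight τ f ε' m := by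
    refine (ae_restrict_iff' measurableSet_Ioi).mpr ?_
    filter_upwards [hae] with m h hm
    have h1 : (0 : ℝ) < m ^ k := pow_pos hm _
    have h2 := (localWeight_pos h₀ hτ hε0 hε hf hpos hm).le
    have h3 := (localWeight_pos h₀ hτ hε'0 hε' hf hpos hm).le
    rw [hgv hε hm, hgv hε' hm] at h
    have h4 := congrArg ENNReal.toReal h
    rw [ENNReal.toReal_mul, ENNReal.toReal_mul, ENNReal.toReal_ofReal (by positivity),
      ENNReal.toReal_ofReal (by positivity), mul_left_comm, mul_left_comm _ (m ^ k)] at h4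
    exact mul_left_cancel₀ h1.ne' h4
  exact Measure.eqOn_open_of_ae_eq hae' isOpen_Ioi
    (continuousOn_const.mul (continuousOn_localWeight h₀ hτ hε hf))
    (continuousOn_const.mul (continuousOn_localWeight h₀ hτ hε' hf)) hm

/-- Proportionality is divided by the volume of the `ε'`-ball and `ε' → 0`, which eliminates the
unknown `ρ`. -/
theorem eventually_localWeight_mul_pow_eq (hτ : IsDispersion τ)
    (hf : ContinuousOn f (Set.Ioi 0)) (hpos : ∀ x, 0 < x → 0 < f x)
    {X : Fin (k + 1) → Ω → ℝ} (hXmeas : ∀ i, Measurable (X i)) (hXindep : iIndepFun X P)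
    (hXlaw : ∀ i, P.map (X i) =
      volume.withDensity ((Set.Ioi 0).indicator fun x => ENNReal.ofReal (f x)))
    (hind : IndepFun (fun ω => mean fun i => X i ω)
      (fun ω => τ (fun i => X i ω) / mean fun i => X i ω) P) {m m' : ℝ} (hm : 0 < m)
    (hm' : 0 < m') :
    ∀ᶠ ε in 𝓝[>] (0 : ℝ),
      localWeight τ f ε m * f m' ^ (k + 1) = localWeight τ f ε m' * f m ^ (k + 1) := by
  obtain ⟨ε₀, hε₀, ρ, hρ, h⟩ :=
    exists_pos_localWeight_proportional hτ hf hpos hXmeas hXindep hXlaw hind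
  have hsmall : ∀ᶠ ε in 𝓝[>] (0 : ℝ), 0 < ε ∧ ε ≤ ε₀ := by
    filter_upwards [self_mem_nhdsWithin, mem_nhdsWithin_of_mem_nhds (Iio_mem_nhds hε₀)]
      with ε h1 h2 using ⟨h1, le_of_lt h2⟩
  filter_upwards [hsmall] with ε hε
  refine tendsto_nhds_unique_of_eventuallyEq
    ((tendsto_localWeight_div hτ hf hm').const_mul (localWeight τ f ε m))
    ((tendsto_localWeight_div hτ hf hm).const_mul (localWeight τ f ε m')) ?_
  filter_upwards [hsmall] with ε' hε'
  rw [← mul_div_assoc, ← mul_div_assoc]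
  congr 1
  refine mul_left_cancel₀ (hρ ε' hε'.1 hε'.2).ne' ?_
  rw [← mul_assoc, ← mul_assoc, h ε ε' m hε.1 hε.2 hε'.1 hε'.2 hm,
    h ε ε' m' hε.1 hε.2 hε'.1 hε'.2 hm']
  ring

end Independence

/-! ### Comparison of weights at two means. -/

section Comparison

variable {k : ℕ} {τ : (Fin (k + 1) → ℝ) → ℝ} {f : ℝ → ℝ}

/-- The total squared deviation over the deviations of dispersion at most `ε`. -/
noncomputable def squaredDeviationIntegral (τ : (Fin (k + 1) → ℝ) → ℝ) (ε : ℝ) : ℝ :=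
  ∫ w in deviationBall τ ε, ∑ i, deviation w i ^ 2

theorem continuous_sum_deviation_sq :
    Continuous fun w : Fin k → ℝ => ∑ i, deviation w i ^ 2 :=
  continuous_finsetSum _ fun i _ => (continuous_deviation_apply i).pow 2

/-- The integrand vanishes only at `w = 0`, a null set because `k ≠ 0`. -/
theorem squaredDeviationIntegral_pos (hk : k ≠ 0) (hτ : IsDispersion τ) {ε : ℝ} (hε : 0 < ε) :
    0 < squaredDeviationIntegral τ ε := by
  have hne : Nonempty (Fin k) := ⟨⟨0, Nat.pos_of_ne_zero hk⟩⟩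
  rw [squaredDeviationIntegral, setIntegral_pos_iff_support_of_nonneg_ae
    (.of_forall fun w => Finset.sum_nonneg fun i _ => sq_nonneg _)
    (continuous_sum_deviation_sq.continuousOn.integrableOn_compact (hτ.isCompact_deviationBall ε))]
  have hsub : deviationBall τ ε \ {0} ⊆
      (Function.support fun w : Fin k → ℝ => ∑ i, deviation w i ^ 2) ∩ deviationBall τ ε := by
    rintro w ⟨hw, hw0⟩
    refine ⟨fun h => hw0 ?_, hw⟩
    have h1 := (Finset.sum_eq_zero_iff_of_nonneg fun i _ => sq_nonneg _).mp h
    refine Set.mem_singleton_iff.mpr (funext fun j => ?_)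
    simpa using h1 j.succ (Finset.mem_univ _)
  refine lt_of_lt_of_le ?_ (measure_mono hsub)
  rw [measure_sdiff_null (measure_singleton _)]
  exact Measure.measure_pos_of_mem_nhds _ (hτ.deviationBall_mem_nhds hε)

theorem setIntegral_one_add_mul_sum_sq (hτ : IsDispersion τ) (ε A B : ℝ) :
    ∫ w in deviationBall τ ε, A * (1 + B * ∑ i, deviation w i ^ 2) =
      A * (volume.real (deviationBall τ ε) + B * squaredDeviationIntegral τ ε) := by
  have hK := hτ.isCompact_deviationBall ε
  have hone : Integrable (fun _ : Fin k → ℝ => (1 : ℝ)) (volume.restrict (deviationBall τ ε)) :=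
    integrableOn_const hK.measure_lt_top.ne
  rw [integral_const_mul, integral_add hone
    ((continuous_sum_deviation_sq.continuousOn.integrableOn_compact hK).const_mul B),
    integral_const_mul, setIntegral_const, smul_eq_mul, mul_one]
  rfl

theorem sum_log_one_add_eq (w : Fin k → ℝ) (L lam d b : ℝ) :
    ∑ i, (L - lam * Real.log (1 + deviation w i) -
        d * (2 * deviation w i + deviation w i ^ 2) - b * deviation w i) =
      (k + 1 : ℕ) * L + (-lam * ∑ i, Real.log (1 + deviation w i) -
        d * ∑ i, deviation w i ^ 2) := by
  simp only [Finset.sum_sub_distrib, ← Finset.mul_sum, Finset.sum_add_distrib, sum_deviation,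
    Finset.sum_const, Finset.card_univ, Fintype.card_fin, nsmul_eq_mul]
  ring

theorem eventually_forall_deviation {m : ℝ} {p : ℝ → Prop} (h : ∀ᶠ t in 𝓝 m, p t) :
    ∀ᶠ w : Fin k → ℝ in 𝓝 0, ∀ i, p (m * (1 + deviation w i)) := by
  refine Filter.eventually_all.mpr fun i => ?_
  have : Filter.Tendsto (fun w : Fin k → ℝ => m * (1 + deviation w i)) (𝓝 0) (𝓝 m) := by
    have hc : Continuous fun w : Fin k → ℝ => m * (1 + deviation w i) :=
      continuous_const.mul (continuous_const.add (continuous_deviation_apply i))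
    simpa using hc.tendsto 0
  exact this.eventually h

theorem exp_sum_log_eq_prod (hpos : ∀ x, 0 < x → 0 < f x) {m : ℝ} {w : Fin k → ℝ}
    (hw : ∀ i, 0 < m * (1 + deviation w i)) :
    Real.exp (∑ i, Real.log (f (m * (1 + deviation w i)))) =
      ∏ i, f (m * (1 + deviation w i)) := by
  rw [Real.exp_sum]
  exact Finset.prod_congr rfl fun i _ => Real.exp_log (hpos _ (hw i))

theorem exp_mul_log_add (hpos : ∀ x, 0 < x → 0 < f x) {m : ℝ} (hm : 0 < m) (y : ℝ) :
    Real.exp ((k + 1 : ℕ) * Real.log (f m) + y) = f m ^ (k + 1) * Real.exp y := by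
  rw [Real.exp_add, Real.exp_nat_mul, Real.exp_log (hpos m hm)]

/-- The local maximum bounds `log f` above near `m`. Summed over the sample, the `β` terms cancel
and the parabola leaves `-δ m ^ 2` times the sum of squares. -/
theorem eventually_localWeight_lt (hk : k ≠ 0) (hτ : IsDispersion τ)
    (hf : ContinuousOn f (Set.Ioi 0)) (hpos : ∀ x, 0 < x → 0 < f x) {m lam δ β : ℝ} (hm : 0 < m)
    (hδ : 0 < δ)
    (hmax : IsLocalMax (fun t => Real.log (f t) + lam * Real.log t + δ * t ^ 2 + β * t) m) :
    ∀ᶠ ε in 𝓝[>] (0 : ℝ), localWeight τ f ε m <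
      f m ^ (k + 1) * (volume.real (deviationBall τ ε) +
        lam / 2 * squaredDeviationIntegral τ ε) := by
  obtain ⟨ε₀, hε₀, h₀⟩ := hτ.exists_pos_half_le
  -- Half of the gain `δ * m ^ 2` absorbs the Taylor error; the other half makes the inequality
  -- strict.
  have hη : 0 < δ * m ^ 2 / 2 := by positivity
  have hfm : 0 < f m ^ (k + 1) := pow_pos (hpos m hm) _
  have hpt : ∀ᶠ w : Fin k → ℝ in 𝓝 0, ∏ i, f (m * (1 + deviation w i)) ≤
      f m ^ (k + 1) * (1 + (lam / 2 - δ * m ^ 2 / 2) * ∑ i, deviation w i ^ 2) := by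
    filter_upwards [eventually_forall_deviation hmax, eventually_forall_deviation
      (eventually_gt_nhds hm), eventually_abs_exp_sum_log_sub_le lam (δ * m ^ 2) hη]
      with w h1 h2 h3
    have h4 (i : Fin (k + 1)) : Real.log (f (m * (1 + deviation w i))) ≤
        Real.log (f m) - lam * Real.log (1 + deviation w i) -
        δ * m ^ 2 * (2 * deviation w i + deviation w i ^ 2) - β * m * deviation w i := by
      have h5 := h1 i
      rw [Real.log_mul hm.ne' (pos_of_mul_pos_right (h2 i) hm.le).ne'] at h5
      linarith
    have h6 := Finset.sum_le_sum fun i (_ : i ∈ Finset.univ) => h4 i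
    rw [sum_log_one_add_eq] at h6
    rw [← exp_sum_log_eq_prod hpos h2]
    refine (Real.exp_le_exp.mpr h6).trans ?_
    rw [exp_mul_log_add hpos hm]
    refine mul_le_mul_of_nonneg_left ?_ hfm.le
    linarith [(abs_le.mp h3).2]
  filter_upwards [hτ.eventually_deviationBall_subset hpt, self_mem_nhdsWithin,
    mem_nhdsWithin_of_mem_nhds (Iio_mem_nhds hε₀)] with ε hsub hε0 hε
  have hQ := squaredDeviationIntegral_pos hk hτ hε0
  have hK := hτ.isCompact_deviationBall ε
  have h1 : localWeight τ f ε m ≤ ∫ w in deviationBall τ ε,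
      f m ^ (k + 1) * (1 + (lam / 2 - δ * m ^ 2 / 2) * ∑ i, deviation w i ^ 2) :=
    setIntegral_mono_on (integrableOn_prod h₀ hτ (le_of_lt hε) hf hm)
      ((continuous_const.mul (continuous_const.add (continuous_const.mul
        continuous_sum_deviation_sq))).continuousOn.integrableOn_compact hK) hK.measurableSet hsub
  rw [setIntegral_one_add_mul_sum_sq hτ] at h1
  refine h1.trans_lt (mul_lt_mul_of_pos_left ?_ hfm)
  nlinarith

theorem eventually_lt_localWeight (hk : k ≠ 0) (hτ : IsDispersion τ)
    (hf : ContinuousOn f (Set.Ioi 0)) (hpos : ∀ x, 0 < x → 0 < f x) {m lam δ β : ℝ} (hm : 0 < m)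
    (hδ : 0 < δ)
    (hmin : IsLocalMin (fun t => Real.log (f t) + lam * Real.log t - δ * t ^ 2 + β * t) m) :
    ∀ᶠ ε in 𝓝[>] (0 : ℝ), f m ^ (k + 1) * (volume.real (deviationBall τ ε) +
        lam / 2 * squaredDeviationIntegral τ ε) < localWeight τ f ε m := by
  obtain ⟨ε₀, hε₀, h₀⟩ := hτ.exists_pos_half_le
  have hη : 0 < δ * m ^ 2 / 2 := by positivity
  have hfm : 0 < f m ^ (k + 1) := pow_pos (hpos m hm) _
  have hpt : ∀ᶠ w : Fin k → ℝ in 𝓝 0,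
      f m ^ (k + 1) * (1 + (lam / 2 + δ * m ^ 2 / 2) * ∑ i, deviation w i ^ 2) ≤
        ∏ i, f (m * (1 + deviation w i)) := by
    filter_upwards [eventually_forall_deviation hmin, eventually_forall_deviation
      (eventually_gt_nhds hm), eventually_abs_exp_sum_log_sub_le lam (-(δ * m ^ 2)) hη]
      with w h1 h2 h3
    have h4 (i : Fin (k + 1)) : Real.log (f m) - lam * Real.log (1 + deviation w i) -
        -(δ * m ^ 2) * (2 * deviation w i + deviation w i ^ 2) - β * m * deviation w i ≤
        Real.log (f (m * (1 + deviation w i))) := by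
      have h5 := h1 i
      rw [Real.log_mul hm.ne' (pos_of_mul_pos_right (h2 i) hm.le).ne'] at h5
      linarith
    have h6 := Finset.sum_le_sum fun i (_ : i ∈ Finset.univ) => h4 i
    rw [sum_log_one_add_eq] at h6
    rw [← exp_sum_log_eq_prod hpos h2]
    refine le_trans ?_ (Real.exp_le_exp.mpr h6)
    rw [exp_mul_log_add hpos hm]
    refine mul_le_mul_of_nonneg_left ?_ hfm.le
    linarith [(abs_le.mp h3).1]
  filter_upwards [hτ.eventually_deviationBall_subset hpt, self_mem_nhdsWithin,
    mem_nhdsWithin_of_mem_nhds (Iio_mem_nhds hε₀)] with ε hsub hε0 hε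
  have hQ := squaredDeviationIntegral_pos hk hτ hε0
  have hK := hτ.isCompact_deviationBall ε
  have h1 : ∫ w in deviationBall τ ε,
      f m ^ (k + 1) * (1 + (lam / 2 + δ * m ^ 2 / 2) * ∑ i, deviation w i ^ 2) ≤
        localWeight τ f ε m :=
    setIntegral_mono_on
      ((continuous_const.mul (continuous_const.add (continuous_const.mul
        continuous_sum_deviation_sq))).continuousOn.integrableOn_compact hK)
      (integrableOn_prod h₀ hτ (le_of_lt hε) hf hm) hK.measurableSet hsub
  rw [setIntegral_one_add_mul_sum_sq hτ] at h1
  refine lt_of_lt_of_le (mul_lt_mul_of_pos_left ?_ hfm) h1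
  nlinarith

/-- Otherwise `localWeight / f ^ (k + 1)` would lie strictly below a threshold at one mean and
strictly above the same threshold at another, although `hprop` makes it constant in the mean. -/
theorem convexOn_or_concaveOn_log_add (hk : k ≠ 0) (hτ : IsDispersion τ)
    (hf : ContinuousOn f (Set.Ioi 0)) (hpos : ∀ x, 0 < x → 0 < f x)
    (hprop : ∀ m m' : ℝ, 0 < m → 0 < m' → ∀ᶠ ε in 𝓝[>] (0 : ℝ),
      localWeight τ f ε m * f m' ^ (k + 1) = localWeight τ f ε m' * f m ^ (k + 1)) (lam : ℝ) :
    ConvexOn ℝ (Set.Ioi 0) (fun t => Real.log (f t) + lam * Real.log t) ∨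
      ConcaveOn ℝ (Set.Ioi 0) (fun t => Real.log (f t) + lam * Real.log t) := by
  by_contra! hcon
  have hg : ContinuousOn (fun t => Real.log (f t) + lam * Real.log t) (Set.Ioi 0) :=
    (hf.log fun x hx => (hpos x hx).ne').add
      (continuousOn_const.mul (continuousOn_id.log fun x hx => ne_of_gt hx))
  obtain ⟨m, δ, β, hm, hδ, hmax⟩ := exists_isLocalMax_of_not_convexOn hg hcon.1
  obtain ⟨m', δ', β', hm', hδ', hmin⟩ := exists_isLocalMin_of_not_concaveOn hg hcon.2
  obtain ⟨ε, h1, h2, h3⟩ := ((eventually_localWeight_lt hk hτ hf hpos hm hδ hmax).and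
    ((eventually_lt_localWeight hk hτ hf hpos hm' hδ' hmin).and (hprop m m' hm hm'))).exists
  have h4 := mul_lt_mul_of_pos_right h1 (pow_pos (hpos m' hm') (k + 1))
  have h5 := mul_lt_mul_of_pos_right h2 (pow_pos (hpos m hm) (k + 1))
  linarith

end Comparison

/-! ### Identification of the gamma density. -/

section GammaIdentification

/-- If `c ≥ 0` the function dominates `x ^ lam`, which is never integrable on the whole half-line;
near `0` the exponential is bounded below, so the power alone must be integrable. -/
theorem neg_and_neg_one_lt_of_integrableOn {lam c : ℝ}
    (h : IntegrableOn (fun x : ℝ => x ^ lam * Real.exp (c * x)) (Set.Ioi 0)) :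
    c < 0 ∧ -1 < lam := by
  have hmeas : AEStronglyMeasurable (fun x : ℝ => x ^ lam) (volume.restrict (Set.Ioi 0)) :=
    (Measurable.aestronglyMeasurable (by fun_prop))
  have hc : c < 0 := by
    by_contra! hc
    refine not_integrableOn_Ioi_rpow lam (Integrable.mono' h hmeas ?_)
    refine (ae_restrict_iff' measurableSet_Ioi).mpr (.of_forall fun x hx => ?_)
    have hx' : 0 ≤ x ^ lam := Real.rpow_nonneg (le_of_lt hx) _
    rw [Real.norm_of_nonneg hx']
    exact le_mul_of_one_le_right hx' (Real.one_le_exp (mul_nonneg hc (le_of_lt hx)))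
  refine ⟨hc, (intervalIntegral.integrableOn_Ioo_rpow_iff one_pos).mp ?_⟩
  -- The factor `exp (-c)` makes `exp (c * x - c) ≥ 1` on `(0, 1)`, as `c < 0`.
  have h1 := (h.mono_set (Set.Ioo_subset_Ioi_self : Set.Ioo (0 : ℝ) 1 ⊆ Set.Ioi 0)).const_mul (Real.exp (-c))
  refine Integrable.mono' h1
    (hmeas.mono_measure (Measure.restrict_mono Set.Ioo_subset_Ioi_self le_rfl)) ?_
  refine (ae_restrict_iff' measurableSet_Ioo).mpr (.of_forall fun x hx => ?_)
  have hx' : 0 ≤ x ^ lam := Real.rpow_nonneg hx.1.le _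
  rw [Real.norm_of_nonneg hx', mul_left_comm, ← Real.exp_add]
  exact le_mul_of_one_le_right hx' (Real.one_le_exp (by nlinarith [hx.2]))

theorem isGammaDistribution_of_log_eq {F : Measure ℝ} [IsProbabilityMeasure F] {f : ℝ → ℝ}
    (hpos : ∀ x, 0 < x → 0 < f x)
    (hF : F = volume.withDensity ((Set.Ioi 0).indicator fun x => ENNReal.ofReal (f x)))
    {lam c d : ℝ} (h : ∀ x, 0 < x → Real.log (f x) = lam * Real.log x + c * x + d) :
    IsGammaDistribution F := by
  have hfx (x : ℝ) (hx : 0 < x) : f x = Real.exp d * (x ^ lam * Real.exp (c * x)) := by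
    rw [← Real.exp_log (hpos x hx), h x hx, Real.rpow_def_of_pos hx, ← Real.exp_add,
      ← Real.exp_add]
    congr 1; ring
  have hmass : ∫⁻ x in Set.Ioi 0, ENNReal.ofReal (f x) = 1 := by
    have := measure_univ (μ := F)
    rwa [hF, withDensity_apply _ .univ, Measure.restrict_univ,
      lintegral_indicator measurableSet_Ioi] at this
  have hint : IntegrableOn (fun x : ℝ => x ^ lam * Real.exp (c * x)) (Set.Ioi 0) := by
    refine ⟨Measurable.aestronglyMeasurable (by fun_prop), ?_⟩
    rw [hasFiniteIntegral_iff_ofReal ((ae_restrict_iff' measurableSet_Ioi).mpr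
      (.of_forall fun x hx => mul_nonneg (Real.rpow_nonneg (le_of_lt hx) _) (Real.exp_nonneg _)))]
    have h1 : ∫⁻ x in Set.Ioi (0 : ℝ), ENNReal.ofReal (x ^ lam * Real.exp (c * x)) =
        ENNReal.ofReal (Real.exp (-d)) * ∫⁻ x in Set.Ioi 0, ENNReal.ofReal (f x) := by
      rw [← lintegral_const_mul' _ _ ENNReal.ofReal_ne_top]
      refine setLIntegral_congr_fun measurableSet_Ioi fun x hx => ?_
      rw [hfx x hx, ← ENNReal.ofReal_mul (Real.exp_nonneg _), ← mul_assoc, ← Real.exp_add]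
      simp
    rw [h1, hmass, mul_one]
    exact ENNReal.ofReal_lt_top
  obtain ⟨hc, hlam⟩ := neg_and_neg_one_lt_of_integrableOn hint
  refine ⟨lam + 1, 1 / -c, by linarith, by simpa using hc, ?_⟩
  rw [one_div_one_div]
  have ha : 0 < lam + 1 := by linarith
  have hr : 0 < -c := by linarith
  have hgamma := isProbabilityMeasure_gammaMeasure ha hr
  have hG := Real.Gamma_pos_of_pos ha
  set K := Real.exp d * Real.Gamma (lam + 1) / (-c) ^ (lam + 1) with hK
  have hpdf : Measurable (gammaPDF (lam + 1) (-c)) :=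
    (measurable_gammaPDFReal _ _).ennreal_ofReal
  have hFK : F = ENNReal.ofReal K • gammaMeasure (lam + 1) (-c) := by
    rw [hF, gammaMeasure, ← withDensity_smul _ hpdf]
    refine withDensity_congr_ae ?_
    have hne : ∀ᵐ x : ℝ, x ≠ 0 := by simp [ae_iff]
    filter_upwards [hne] with x hx
    rcases lt_or_gt_of_ne hx with hx | hx
    · rw [Set.indicator_of_notMem (by simpa using hx.le), Pi.smul_apply, gammaPDF_of_neg hx,
        smul_zero]
    · rw [Set.indicator_of_mem (Set.mem_Ioi.mpr hx), Pi.smul_apply, gammaPDF_of_nonneg hx.le,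
        smul_eq_mul, ← ENNReal.ofReal_mul (by positivity), hfx x hx, hK]
      congr 1
      have : (-c) ^ (lam + 1) ≠ 0 := (Real.rpow_pos_of_pos hr _).ne'
      simp only [add_sub_cancel_right, neg_mul, neg_neg]
      field_simp
  -- Both measures have mass one, so `d` need not be computed.
  have hK1 : ENNReal.ofReal K = 1 := by
    have := measure_univ (μ := F)
    rwa [hFK, Measure.smul_apply, measure_univ, smul_eq_mul, mul_one] at this
  rw [hFK, hK1, one_smul]

end GammaIdentification

theorem indepFun_mean_dispersion_iff_isGammaDistribution {Ω : Type*} [MeasurableSpace Ω]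
    {P : Measure Ω} [IsProbabilityMeasure P] {k : ℕ} (hk : k ≠ 0)
    {τ : (Fin (k + 1) → ℝ) → ℝ} (hτ : IsDispersion τ)
    {F : Measure ℝ} (hF : HasPositiveContinuousDensity F)
    {X : Fin (k + 1) → Ω → ℝ} (hXmeas : ∀ i, Measurable (X i)) (hXindep : iIndepFun X P)
    (hXlaw : ∀ i, P.map (X i) = F) :
    IndepFun (fun ω => mean fun i => X i ω)
      (fun ω => τ (fun i => X i ω) / mean fun i => X i ω) P ↔ IsGammaDistribution F := by
  constructor
  · intro hind
    obtain ⟨f, hf, hpos, hFf⟩ := hF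
    rw [← withDensity_indicator measurableSet_Ioi] at hFf
    have hprob : IsProbabilityMeasure F := by
      rw [← hXlaw 0]; exact Measure.isProbabilityMeasure_map (hXmeas 0).aemeasurable
    obtain ⟨lam, c, d, h⟩ := exists_eq_log_add_affine
      (convexOn_or_concaveOn_log_add hk hτ hf hpos fun m m' hm hm' =>
        eventually_localWeight_mul_pow_eq hτ hf hpos hXmeas hXindep
          (fun i => (hXlaw i).trans hFf) hind hm hm')
    exact isGammaDistribution_of_log_eq hpos hFf h
  · rintro ⟨a, b, -, -, rfl⟩
    exact indepFun_mean_dispersion_of_gamma hτ hXmeas hXindep hXlaw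

end GammaCharacterization

theorem corollary7
    {Ω : Type*} [MeasurableSpace Ω] (P : Measure Ω) [IsProbabilityMeasure P]
    (n : ℕ) (hn : 3 ≤ n)
    (F : Measure ℝ) (hF : GammaCharacterization.HasPositiveContinuousDensity F)
    (X : Fin n → Ω → ℝ) (hXmeas : ∀ i, Measurable (X i))
    (hXindep : iIndepFun X P) (hXlaw : ∀ i, P.map (X i) = F)
    (p q : ℝ) (hp : 0 < p) (hq : 0 < q)
    (a : Fin n → Fin n → ℝ) (ha : ∀ i j, 0 ≤ a i j)
    (ha_first : 0 < a ⟨0, by omega⟩ ⟨0, by omega⟩)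
    (ha_last : 0 < a ⟨n - 1, by omega⟩ ⟨n - 1, by omega⟩) :
    IndepFun
        (fun ω => GammaCharacterization.mean (fun i => X i ω))
        (fun ω => GammaCharacterization.zStatistic p q a (fun i => X i ω) ^ (1 / (p + q)) /
          GammaCharacterization.mean (fun i => X i ω)) P ↔
      GammaCharacterization.IsGammaDistribution F := by
  obtain ⟨k, rfl⟩ : ∃ k, n = k + 1 := ⟨n - 1, by omega⟩
  exact GammaCharacterization.indepFun_mean_dispersion_iff_isGammaDistribution (by omega)
    (GammaCharacterization.isDispersion_zStatistic_rpow (by omega) hp hq ha ha_first ha_last)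
    hF hXmeas hXindep hXlaw
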